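/- Let $M$ be a smooth $3$-manifold with a paracontact metric structure $(\phi,\xi,\eta,g)$: $\phi$ is a smooth $(1,1)$-tensor field, $\xi$ a smooth vector field, $\eta$ a smooth $1$-form and $g$ a smooth pseudo-Riemannian metric with $$\phi^2=I-\eta\otimes\xi,\qquad \eta(\xi)=1,\qquad g(\phi X,\phi Y)=-g(X,Y)+\eta(X)\eta(Y),\qquad d\eta(X,Y)=g(X,\phi Y)$$ for all vector fields $X,Y$, where $d\eta(X,Y)=\tfrac12\bigl(X\eta(Y)-Y\eta(X)-\eta([X,Y])\bigr)$, and such that the eigendistributions of $\phi$ for the eigenvalues $1$ and $-1$ have equal dimension. Let $\nabla$ be the Levi-Civita connection of $g$, $R(X,Y)Z=\nabla_X\nabla_YZ-\nabla_Y\nabla_XZ-\nabla_{[X,Y]}Z$ its curvature tensor, and $S$ its Ricci operator, defined by $g(SX,Y)=\mathrm{Ric}(X,Y)$ with $\mathrm{Ric}(Y,Z)=\mathrm{Tr}\,(X\mapsto R(X,Y)Z)$. Put $h=\tfrac12 L_\xi\phi$, where $L$ is the Lie derivative, and $lX=R(X,\xi)\xi$. If $S\phi=\phi S$, then (i) $l\phi=\phi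 l$; (ii) $l=h^2-\phi^2$; (iii) $\nabla_\xi h=0$, and the function $\mathrm{Tr}\,l$ is differentiable with $\xi(\mathrm{Tr}\,l)=0$. -/

import Mathlib

set_option maxSynthPendingDepth 3

open Bundle Set
open scoped Manifold ContDiff

noncomputable section

namespace PseudoRiemannian

section Local

variable {E : Type*} [NormedAddCommGroup E] [NormedSpace ℝ E]

/-- Christoffel symbols of the first kind of a field `G` of bilinear forms on `E`:
`(v, w, z) ↦ ½ (∂_v G(w, z) + ∂_w G(v, z) - ∂_z G(v, w))`, see `christoffelFirst_apply`. -/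
def christoffelFirst (G : E → E →L[ℝ] E →L[ℝ] ℝ) (y : E) : E →L[ℝ] E →L[ℝ] E →L[ℝ] ℝ :=
  letI dG : E →L[ℝ] E →L[ℝ] E →L[ℝ] ℝ := fderiv ℝ G y
  (1 / 2 : ℝ) • (dG + dG.flip -
    ((ContinuousLinearMap.flipₗᵢ ℝ E E ℝ : (E →L[ℝ] E →L[ℝ] ℝ) →L[ℝ] E →L[ℝ] E →L[ℝ] ℝ) ∘L
      dG.flip))

theorem christoffelFirst_apply (G : E → E →L[ℝ] E →L[ℝ] ℝ) (y v w z : E) :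
    christoffelFirst G y v w z =
      1 / 2 * (fderiv ℝ G y v w z + fderiv ℝ G y w v z - fderiv ℝ G y z v w) := by
  simp [christoffelFirst]

/-- Christoffel symbols (of the second kind) of `G`: `Γ(v, w)` is the vector with
`G(Γ(v, w), ·) = christoffelFirst G y v w`. -/
def christoffel (G : E → E →L[ℝ] E →L[ℝ] ℝ) (y : E) : E →L[ℝ] E →L[ℝ] E :=
  (ContinuousLinearMap.compL ℝ E (E →L[ℝ] ℝ) E (G y).inverse) ∘L christoffelFirst G y

theorem christoffel_apply (G : E → E →L[ℝ] E →L[ℝ] ℝ) (y v w : E) :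
    christoffel G y v w = (G y).inverse (christoffelFirst G y v w) := by
  simp [christoffel]

/-- The curvature tensor of `G` in coordinates, see `localCurvature_apply`. -/
def localCurvature (G : E → E →L[ℝ] E →L[ℝ] ℝ) (y : E) : E →L[ℝ] E →L[ℝ] E →L[ℝ] E :=
  letI dΓ : E →L[ℝ] E →L[ℝ] E →L[ℝ] E := fderiv ℝ (christoffel G) y
  letI ΓΓ : E →L[ℝ] E →L[ℝ] E →L[ℝ] E :=
    (ContinuousLinearMap.compL ℝ E E E).bilinearComp (christoffel G y) (christoffel G y)
  dΓ - dΓ.flip + ΓΓ - ΓΓ.flip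

theorem localCurvature_apply (G : E → E →L[ℝ] E →L[ℝ] ℝ) (y u v w : E) :
    localCurvature G y u v w =
      fderiv ℝ (christoffel G) y u v w - fderiv ℝ (christoffel G) y v u w
        + christoffel G y u (christoffel G y v w) - christoffel G y v (christoffel G y u w) := by
  simp [localCurvature]

end Local

variable (E : Type*) [NormedAddCommGroup E] [NormedSpace ℝ E]
  (M : Type*) [TopologicalSpace M] [ChartedSpace E M] [IsManifold 𝓘(ℝ, E) ∞ M]

/-- A smooth pseudo-Riemannian metric on the manifold `M` (of arbitrary signature): a smooth field
of nondegenerate symmetric bilinear forms on the tangent spaces. -/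
structure Metric where
  /-- The bilinear form on the tangent space at a point. -/
  val (x : M) : TangentSpace 𝓘(ℝ, E) x →L[ℝ] TangentSpace 𝓘(ℝ, E) x →L[ℝ] ℝ
  symm (x : M) (v w : TangentSpace 𝓘(ℝ, E) x) : val x v w = val x w v
  nondegenerate (x : M) (v : TangentSpace 𝓘(ℝ, E) x) (hv : ∀ w, val x v w = 0) : v = 0
  contMDiff : ContMDiff 𝓘(ℝ, E) (𝓘(ℝ, E).prod 𝓘(ℝ, E →L[ℝ] E →L[ℝ] ℝ)) ∞
    (fun x ↦ TotalSpace.mk' (E →L[ℝ] E →L[ℝ] ℝ)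
      (E := fun x : M ↦ TangentSpace 𝓘(ℝ, E) x →L[ℝ] TangentSpace 𝓘(ℝ, E) x →L[ℝ] ℝ) x (val x))

variable {E M}

/-- The differential at `x` of the preferred chart at `x`, which identifies the tangent space at `x`
with `E`. -/
def chartDeriv (x : M) : TangentSpace 𝓘(ℝ, E) x →L[ℝ] E :=
  mfderiv 𝓘(ℝ, E) 𝓘(ℝ, E) (extChartAt 𝓘(ℝ, E) x) x

namespace Metric

variable (g : Metric E M)

/-- The metric read in the preferred chart at `x₀`: the pullback of `g` under the inverse of the
chart, a field of bilinear forms on (the target of the chart in) `E`. -/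
def inChart (x₀ : M) (y : E) : E →L[ℝ] E →L[ℝ] ℝ :=
  letI D : E →L[ℝ] TangentSpace 𝓘(ℝ, E) ((extChartAt 𝓘(ℝ, E) x₀).symm y) :=
    mfderivWithin 𝓘(ℝ, E) 𝓘(ℝ, E) (extChartAt 𝓘(ℝ, E) x₀).symm (range 𝓘(ℝ, E)) y
  ((ContinuousLinearMap.precomp ℝ D).comp (g.val ((extChartAt 𝓘(ℝ, E) x₀).symm y))).comp D

/-- The Levi-Civita connection: `g.leviCivita Y x v` is `∇_v Y`, for a vector field `Y` (which
should be differentiable at `x`) and a tangent vector `v` at `x`. In the chart at `x` it is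
`∂_v Y + Γ(v, Y)`. -/
def leviCivita (Y : Π x : M, TangentSpace 𝓘(ℝ, E) x) (x : M) (v : TangentSpace 𝓘(ℝ, E) x) :
    TangentSpace 𝓘(ℝ, E) x :=
  letI Y' : E → E := VectorField.mpullbackWithin 𝓘(ℝ, E) 𝓘(ℝ, E)
    (extChartAt 𝓘(ℝ, E) x).symm Y (range 𝓘(ℝ, E))
  (chartDeriv x).inverse (fderiv ℝ Y' (extChartAt 𝓘(ℝ, E) x x) (chartDeriv x v)
    + christoffel (g.inChart x) (extChartAt 𝓘(ℝ, E) x x) (chartDeriv x v)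
      (Y' (extChartAt 𝓘(ℝ, E) x x)))

/-- The covariant derivative `(∇_X T) Y = ∇_X (T Y) - T (∇_X Y)` of a field `T` of endomorphisms
of the tangent spaces. -/
def covDerivEnd (T : Π x : M, TangentSpace 𝓘(ℝ, E) x → TangentSpace 𝓘(ℝ, E) x)
    (X Y : Π x : M, TangentSpace 𝓘(ℝ, E) x) (x : M) : TangentSpace 𝓘(ℝ, E) x :=
  g.leviCivita (fun y ↦ T y (Y y)) x (X x) - T x (g.leviCivita Y x (X x))

/-- The curvature tensor `R(u, v)w` at `x`, where
`R(X, Y)Z = ∇_X ∇_Y Z - ∇_Y ∇_X Z - ∇_[X,Y] Z`. -/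
def curvature (x : M) (u v w : TangentSpace 𝓘(ℝ, E) x) : TangentSpace 𝓘(ℝ, E) x :=
  (chartDeriv x).inverse (localCurvature (g.inChart x) (extChartAt 𝓘(ℝ, E) x x)
    (chartDeriv x u) (chartDeriv x v) (chartDeriv x w))

/-- The Ricci tensor `Ric(v, w) = Tr (u ↦ R(u, v)w)`. -/
def ricci (x : M) (v w : TangentSpace 𝓘(ℝ, E) x) : ℝ :=
  LinearMap.trace ℝ (TangentSpace 𝓘(ℝ, E) x)
    { toFun := fun u ↦ g.curvature x u v w
      map_add' := by intro u u'; simp [curvature]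
      map_smul' := by intro c u; simp [curvature] }

theorem ricci_add_right (x : M) (v w w' : TangentSpace 𝓘(ℝ, E) x) :
    g.ricci x v (w + w') = g.ricci x v w + g.ricci x v w' := by
  unfold ricci
  rw [← map_add]
  congr 1
  ext u
  simp [curvature]

theorem ricci_smul_right (x : M) (c : ℝ) (v w : TangentSpace 𝓘(ℝ, E) x) :
    g.ricci x v (c • w) = c * g.ricci x v w := by
  unfold ricci
  rw [← smul_eq_mul, ← map_smul]
  congr 1
  ext u
  simp [curvature]

/-- The Ricci operator `S`: `S v` is the tangent vector with `g(S v, w) = Ric(v, w)` for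
all `w`. -/
def ricciOperator [FiniteDimensional ℝ E] (x : M) (v : TangentSpace 𝓘(ℝ, E) x) :
    TangentSpace 𝓘(ℝ, E) x :=
  haveI : FiniteDimensional ℝ (TangentSpace 𝓘(ℝ, E) x) := inferInstanceAs (FiniteDimensional ℝ E)
  haveI : T2Space (TangentSpace 𝓘(ℝ, E) x) := inferInstanceAs (T2Space E)
  (g.val x).inverse (LinearMap.toContinuousLinearMap
    { toFun := fun w ↦ g.ricci x v w
      map_add' := g.ricci_add_right x v
      map_smul' := fun c w ↦ g.ricci_smul_right x c v w })

end Metric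

end PseudoRiemannian

namespace Paracontact

variable (E : Type*) [NormedAddCommGroup E] [NormedSpace ℝ E]
  (M : Type*) [TopologicalSpace M] [ChartedSpace E M] [IsManifold 𝓘(ℝ, E) ∞ M]

/-- A paracontact metric structure `(φ, ξ, η, g)` on the manifold `M`. The exterior derivative is
normalised as `dη(X, Y) = ½ (X η(Y) - Y η(X) - η([X, Y]))`. -/
structure MetricStructure where
  /-- The `(1, 1)` tensor field. -/
  φ (x : M) : TangentSpace 𝓘(ℝ, E) x →L[ℝ] TangentSpace 𝓘(ℝ, E) x
  /-- The characteristic (Reeb) vector field. -/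
  ξ (x : M) : TangentSpace 𝓘(ℝ, E) x
  /-- The contact form. -/
  η (x : M) : TangentSpace 𝓘(ℝ, E) x →L[ℝ] ℝ
  /-- The associated pseudo-Riemannian metric. -/
  g : PseudoRiemannian.Metric E M
  contMDiff_φ : ContMDiff 𝓘(ℝ, E) (𝓘(ℝ, E).prod 𝓘(ℝ, E →L[ℝ] E)) ∞
    (fun x ↦ TotalSpace.mk' (E →L[ℝ] E)
      (E := fun x : M ↦ TangentSpace 𝓘(ℝ, E) x →L[ℝ] TangentSpace 𝓘(ℝ, E) x) x (φ x))
  contMDiff_ξ : ContMDiff 𝓘(ℝ, E) (𝓘(ℝ, E).prod 𝓘(ℝ, E)) ∞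
    (fun x ↦ TotalSpace.mk' E (E := fun x : M ↦ TangentSpace 𝓘(ℝ, E) x) x (ξ x))
  contMDiff_η : ContMDiff 𝓘(ℝ, E) (𝓘(ℝ, E).prod 𝓘(ℝ, E →L[ℝ] ℝ)) ∞
    (fun x ↦ TotalSpace.mk' (E →L[ℝ] ℝ)
      (E := fun x : M ↦ TangentSpace 𝓘(ℝ, E) x →L[ℝ] ℝ) x (η x))
  φ_φ (x : M) (v : TangentSpace 𝓘(ℝ, E) x) : φ x (φ x v) = v - η x v • ξ x
  η_ξ (x : M) : η x (ξ x) = 1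
  /-- The eigendistributions of `φ` for the eigenvalues `1` and `-1` have equal dimension. -/
  finrank_eigenspace (x : M) :
    Module.finrank ℝ (Module.End.eigenspace (φ x : Module.End ℝ (TangentSpace 𝓘(ℝ, E) x)) 1) =
    Module.finrank ℝ (Module.End.eigenspace (φ x : Module.End ℝ (TangentSpace 𝓘(ℝ, E) x)) (-1))
  g_φ_φ (x : M) (v w : TangentSpace 𝓘(ℝ, E) x) :
    g.val x (φ x v) (φ x w) = -g.val x v w + η x v * η x w
  dη_eq (x : M) (X Y : Π x : M, TangentSpace 𝓘(ℝ, E) x) (hX : MDiffAt (T% X) x)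
    (hY : MDiffAt (T% Y) x) :
    1 / 2 * (mvfderiv 𝓘(ℝ, E) (fun y ↦ η y (Y y)) x (X x)
      - mvfderiv 𝓘(ℝ, E) (fun y ↦ η y (X y)) x (Y x)
      - η x (VectorField.mlieBracket 𝓘(ℝ, E) X Y x)) = g.val x (X x) (φ x (Y x))

variable {E M}

namespace MetricStructure

variable (P : MetricStructure E M)

/-- The Lie derivative `(L_ξ φ) X = [ξ, φ X] - φ [ξ, X]`, on vector fields. -/
def lieφ (X : Π x : M, TangentSpace 𝓘(ℝ, E) x) (x : M) : TangentSpace 𝓘(ℝ, E) x :=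
  VectorField.mlieBracket 𝓘(ℝ, E) P.ξ (fun y ↦ P.φ y (X y)) x
    - P.φ x (VectorField.mlieBracket 𝓘(ℝ, E) P.ξ X x)

theorem mdiffAt_φ {X : Π x : M, TangentSpace 𝓘(ℝ, E) x} {x : M} (hX : MDiffAt (T% X) x) :
    MDiffAt (T% (fun y ↦ P.φ y (X y))) x :=
  MDifferentiableAt.clm_bundle_apply (F₁ := E) (F₂ := E)
    ((P.contMDiff_φ x).mdifferentiableAt (by simp)) hX

theorem tensorialAt_lieφ [CompleteSpace E] (x : M) :
    TensorialAt 𝓘(ℝ, E) E (fun X : Π x : M, TangentSpace 𝓘(ℝ, E) x ↦ P.lieφ X x) x := by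
  have : IsManifold 𝓘(ℝ, E) 2 M := IsManifold.of_le (n := ∞) (by norm_cast)
  refine ⟨fun {f X} hf hX ↦ ?_, fun {X Y} hX hY ↦ ?_⟩
  · have h1 : (fun y ↦ P.φ y ((f • X) y)) = f • (fun y ↦ P.φ y (X y)) := by
      ext y; simp
    simp only [lieφ, h1]
    rw [VectorField.mlieBracket_smul_right hf (P.mdiffAt_φ hX),
      VectorField.mlieBracket_smul_right hf hX]
    simp only [map_add, map_smul]
    module
  · have h1 : (fun y ↦ P.φ y ((X + Y) y)) = (fun y ↦ P.φ y (X y)) + (fun y ↦ P.φ y (Y y)) := by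
      ext y; simp
    simp only [lieφ, h1]
    rw [VectorField.mlieBracket_add_right (P.mdiffAt_φ hX) (P.mdiffAt_φ hY),
      VectorField.mlieBracket_add_right hX hY]
    simp only [map_add]
    abel

/-- The tensor field `h = ½ L_ξ φ`. -/
def h [FiniteDimensional ℝ E] (x : M) : TangentSpace 𝓘(ℝ, E) x →L[ℝ] TangentSpace 𝓘(ℝ, E) x :=
  haveI : CompleteSpace E := FiniteDimensional.complete ℝ E
  (1 / 2 : ℝ) • TensorialAt.mkHom (fun X ↦ P.lieφ X x) x (P.tensorialAt_lieφ x)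

/-- The tensor field `l = R(·, ξ)ξ`. -/
def l (x : M) : TangentSpace 𝓘(ℝ, E) x →ₗ[ℝ] TangentSpace 𝓘(ℝ, E) x where
  toFun v := P.g.curvature x v (P.ξ x) (P.ξ x)
  map_add' := by intro u u'; simp [PseudoRiemannian.Metric.curvature]
  map_smul' := by intro c u; simp [PseudoRiemannian.Metric.curvature]

/-- The function `Tr l`. -/
def traceL (x : M) : ℝ := LinearMap.trace ℝ (TangentSpace 𝓘(ℝ, E) x) (P.l x)

end MetricStructure

end Paracontact

end

/-! Read everything in a chart, where ∇ is ∂ + Γ and tensor fields are functions valued in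
(multi)linear maps, and put A = ∇ξ. Since dη is closed and ι_ξ dη = 0, L_ξ dη = 0; with φ² = I − η⊗ξ
this forces ∇_ξφ = 0 and Aφ + φA = −2φ². Hence A = φh − φ, hφ + φh = 0 and A² = φ² − h². Inserted
into R(v,ξ)ξ = −(∇_ξA)v − A²v, these give in every dimension l = h² − φ² − φ∇_ξh
(`localCurvature_Ξ_Ξ`).

As φ is g-skew, Sφ = φS says Ric(φv,w) = −Ric(v,φw). In dimension 3 take an orthogonal frame e, φe,
ξ, where g(φe,φe) = −g(e,e). The curvature of the plane of e and φe cancels from this relation, and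
what remains on ker η is lφ = φl (`localCurvature_Φ_Ξ_Ξ`).

Now h² and φ² commute with φ while ∇_ξh anticommutes with it, so lφ − φl = 2φ²∇_ξh = 2∇_ξh. Thus (i)
yields ∇_ξh = 0, and the formula for l becomes (ii). Finally Tr l = Tr h² − Tr φ², and the trace of
the square of a ξ-parallel endomorphism field has zero derivative along ξ.

Connection and curvature at x are defined through the chart at x, so they are used only at the
centre of that chart. By contrast φ and h can be read near x in one fixed chart; through (ii) this
makes Tr l differentiable. -/

noncomputable section

/-! ### Differentiating identities on open sets -/

section Calculus

variable {E F : Type*} [NormedAddCommGroup E] [NormedSpace ℝ E]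
  [NormedAddCommGroup F] [NormedSpace ℝ F]

/-- The device for differentiating a tensor identity valid on an open set: compute the derivative of
each side and equate. -/
theorem IsOpen.hasFDerivAt_unique_of_eqOn {U : Set E} (hU : IsOpen U) {f g : E → F}
    {f' g' : E →L[ℝ] F} {y : E} (hy : y ∈ U) (hf : HasFDerivAt f f' y) (hg : HasFDerivAt g g' y)
    (h : ∀ z ∈ U, f z = g z) : f' = g' :=
  hf.unique (hg.congr_of_eventuallyEq (Filter.eventuallyEq_of_mem (hU.mem_nhds hy) h))

theorem ContDiffOn.hasFDerivAt_of_isOpen {U : Set E} (hU : IsOpen U) {f : E → F}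
    (hf : ContDiffOn ℝ ∞ f U) {y : E} (hy : y ∈ U) : HasFDerivAt f (fderiv ℝ f y) y :=
  ((hf.contDiffAt (hU.mem_nhds hy)).differentiableAt (by simp)).hasFDerivAt

theorem ContDiffOn.fderiv_fderiv_comm {U : Set E} (hU : IsOpen U) {f : E → F}
    (hf : ContDiffOn ℝ ∞ f U) {y : E} (hy : y ∈ U) (u v : E) :
    fderiv ℝ (fderiv ℝ f) y u v = fderiv ℝ (fderiv ℝ f) y v u :=
  (hf.contDiffAt (hU.mem_nhds hy)).isSymmSndFDerivAt (by simp; norm_cast) u v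

theorem HasFDerivAt.clm_apply_const {G : Type*} [NormedAddCommGroup G] [NormedSpace ℝ G]
    {c : E → F →L[ℝ] G} {c' : E →L[ℝ] F →L[ℝ] G} {y : E} (hc : HasFDerivAt c c' y) (u : F) :
    HasFDerivAt (fun z ↦ c z u) (c'.flip u) y := by
  simpa using hc.clm_apply (hasFDerivAt_const u y)

end Calculus

/-! ### Levi-Civita calculus in coordinates -/

namespace PseudoRiemannian

variable {E : Type*} [NormedAddCommGroup E] [NormedSpace ℝ E]

/-- A smooth field of nondegenerate symmetric bilinear forms on an open subset of `E`. -/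
structure IsLocalMetric (G : E → E →L[ℝ] E →L[ℝ] ℝ) (U : Set E) : Prop where
  isOpen : IsOpen U
  smooth : ContDiffOn ℝ ∞ G U
  symm : ∀ y ∈ U, ∀ v w, G y v w = G y w v
  nondegenerate : ∀ y ∈ U, ∀ v, (∀ w, G y v w = 0) → v = 0

/-- Injectivity and equality of dimensions. Without invertibility `inverse` takes its default value
0, so the Christoffel symbols and the Ricci operator depend on this. -/
theorem isInvertible_of_nondegenerate [FiniteDimensional ℝ E] {B : E →L[ℝ] E →L[ℝ] ℝ}
    (hB : ∀ v, (∀ w, B v w = 0) → v = 0) : B.IsInvertible := by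
  have hinj : Function.Injective (B : E →ₗ[ℝ] E →L[ℝ] ℝ) := by
    rw [← LinearMap.ker_eq_bot, LinearMap.ker_eq_bot']
    exact fun v hv ↦ hB v fun w ↦ by simpa using DFunLike.congr_fun hv w
  have hdim : Module.finrank ℝ E = Module.finrank ℝ (E →L[ℝ] ℝ) := by
    rw [← (LinearMap.toContinuousLinearMap (𝕜 := ℝ) (E := E) (F' := ℝ)).finrank_eq]
    exact Subspace.dual_finrank_eq.symm
  refine ⟨(LinearEquiv.ofInjectiveOfFinrankEq
    (B : E →ₗ[ℝ] E →L[ℝ] ℝ) hinj hdim).toContinuousLinearEquiv, ?_⟩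
  ext v w
  rfl

theorem localCurvature_antisymm_left (G : E → E →L[ℝ] E →L[ℝ] ℝ) (y u v w : E) :
    localCurvature G y u v w = -localCurvature G y v u w := by
  simp only [localCurvature_apply]
  abel

namespace IsLocalMetric

variable {G : E → E →L[ℝ] E →L[ℝ] ℝ} {U : Set E} {y : E}

theorem eq_of_forall (hG : IsLocalMetric G U) (hy : y ∈ U) {v v' : E}
    (h : ∀ w, G y v w = G y v' w) : v = v' :=
  sub_eq_zero.1 (hG.nondegenerate y hy _ fun w ↦ by simp [h w])

theorem hasFDerivAt (hG : IsLocalMetric G U) (hy : y ∈ U) : HasFDerivAt G (fderiv ℝ G y) y :=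
  hG.smooth.hasFDerivAt_of_isOpen hG.isOpen hy

theorem fderiv_symm (hG : IsLocalMetric G U) (hy : y ∈ U) (u v w : E) :
    fderiv ℝ G y u v w = fderiv ℝ G y u w v := by
  have := hG.isOpen.hasFDerivAt_unique_of_eqOn hy
    (((hG.hasFDerivAt hy).clm_apply_const v).clm_apply_const w)
    (((hG.hasFDerivAt hy).clm_apply_const w).clm_apply_const v)
    (fun z hz ↦ hG.symm z hz v w)
  simpa using DFunLike.congr_fun this u

theorem contDiffOn_christoffelFirst [FiniteDimensional ℝ E] (hG : IsLocalMetric G U) :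
    ContDiffOn ℝ ∞ (christoffelFirst G) U := by
  have h : ContDiffOn ℝ ∞ (fderiv ℝ G) U := hG.smooth.fderiv_of_isOpen hG.isOpen (by simp)
  refine contDiffOn_clm_apply.2 fun v ↦ contDiffOn_clm_apply.2 fun w ↦
    contDiffOn_clm_apply.2 fun z ↦ ?_
  simp only [christoffelFirst_apply]
  have h' (a b c : E) : ContDiffOn ℝ ∞ (fun y ↦ fderiv ℝ G y a b c) U :=
    ((h.clm_apply contDiffOn_const).clm_apply contDiffOn_const).clm_apply contDiffOn_const
  exact contDiffOn_const.mul (((h' _ _ _).add (h' _ _ _)).sub (h' _ _ _))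

variable [FiniteDimensional ℝ E]

theorem contDiffOn_christoffel (hG : IsLocalMetric G U) :
    ContDiffOn ℝ ∞ (christoffel G) U := by
  have : CompleteSpace E := FiniteDimensional.complete ℝ E
  refine contDiffOn_clm_apply.2 fun v ↦ contDiffOn_clm_apply.2 fun w ↦ ?_
  simp only [christoffel_apply]
  refine ContDiffOn.clm_apply (fun y hy ↦ ?_)
    ((hG.contDiffOn_christoffelFirst.clm_apply contDiffOn_const).clm_apply contDiffOn_const)
  obtain ⟨e, he⟩ := isInvertible_of_nondegenerate (hG.nondegenerate y hy)
  have := contDiffAt_map_inverse (n := ∞) e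
  rw [he] at this
  exact this.comp_contDiffWithinAt y (hG.smooth y hy)

theorem hasFDerivAt_christoffel (hG : IsLocalMetric G U) (hy : y ∈ U) :
    HasFDerivAt (christoffel G) (fderiv ℝ (christoffel G) y) y :=
  hG.contDiffOn_christoffel.hasFDerivAt_of_isOpen hG.isOpen hy

theorem apply_christoffel (hG : IsLocalMetric G U) (hy : y ∈ U) (v w z : E) :
    G y (christoffel G y v w) z =
      1 / 2 * (fderiv ℝ G y v w z + fderiv ℝ G y w v z - fderiv ℝ G y z v w) := by
  rw [christoffel_apply, (isInvertible_of_nondegenerate (hG.nondegenerate y hy)).self_apply_inverse,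
    christoffelFirst_apply]

theorem christoffel_symm (hG : IsLocalMetric G U) (hy : y ∈ U) (v w : E) :
    christoffel G y v w = christoffel G y w v := by
  refine hG.eq_of_forall hy fun z ↦ ?_
  rw [hG.apply_christoffel hy, hG.apply_christoffel hy, hG.fderiv_symm hy z]
  ring

/-- Metric compatibility, ∇G = 0. -/
theorem fderiv_eq_christoffel (hG : IsLocalMetric G U) (hy : y ∈ U) (u v w : E) :
    fderiv ℝ G y u v w = G y (christoffel G y u v) w + G y v (christoffel G y u w) := by
  rw [hG.symm y hy v, hG.apply_christoffel hy, hG.apply_christoffel hy, hG.fderiv_symm hy u w v,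
    hG.fderiv_symm hy v u w, hG.fderiv_symm hy w u v]
  ring

/-- Differentiate ∇G = 0 once more and antisymmetrise in the two directions: the second derivatives
of G cancel, and the curvature acting on G remains. -/
theorem localCurvature_antisymm_right (hG : IsLocalMetric G U) (hy : y ∈ U) (s u v w : E) :
    G y (localCurvature G y s u v) w = -G y v (localCurvature G y s u w) := by
  have hdG : HasFDerivAt (fderiv ℝ G) (fderiv ℝ (fderiv ℝ G) y) y :=
    ContDiffOn.hasFDerivAt_of_isOpen hG.isOpen (hG.smooth.fderiv_of_isOpen hG.isOpen (by simp)) hy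
  have key (s u v w : E) : fderiv ℝ (fderiv ℝ G) y s u v w =
      fderiv ℝ G y s (christoffel G y u v) w + G y (fderiv ℝ (christoffel G) y s u v) w
      + (fderiv ℝ G y s v (christoffel G y u w) + G y v (fderiv ℝ (christoffel G) y s u w)) := by
    have hΓ (a b : E) := ((hG.hasFDerivAt_christoffel hy).clm_apply_const a).clm_apply_const b
    have := hG.isOpen.hasFDerivAt_unique_of_eqOn hy
      (((hdG.clm_apply_const u).clm_apply_const v).clm_apply_const w)
      ((((hG.hasFDerivAt hy).clm_apply (hΓ u v)).clm_apply_const w).add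
        (((hG.hasFDerivAt hy).clm_apply_const v).clm_apply (hΓ u w)))
      (fun z hz ↦ hG.fderiv_eq_christoffel hz u v w)
    have := DFunLike.congr_fun this s
    simp at this
    linarith
  have h1 := key s u v w
  have h2 := key u s v w
  rw [hG.smooth.fderiv_fderiv_comm hG.isOpen hy] at h1
  simp only [hG.fderiv_eq_christoffel hy] at h1 h2
  simp only [localCurvature_apply, map_add, map_sub, add_apply,
    sub_apply]
  linarith

end IsLocalMetric

end PseudoRiemannian

/-! ### Paracontact structures on an open subset of a vector space -/

namespace Paracontact

open PseudoRiemannian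

variable {E : Type*} [NormedAddCommGroup E] [NormedSpace ℝ E]

/-- A paracontact metric structure on an open subset of a vector space. -/
structure IsLocalStructure (G : E → E →L[ℝ] E →L[ℝ] ℝ) (Φ : E → E →L[ℝ] E) (Ξ : E → E)
    (η : E → E →L[ℝ] ℝ) (U : Set E) : Prop extends IsLocalMetric G U where
  smooth_Φ : ContDiffOn ℝ ∞ Φ U
  smooth_Ξ : ContDiffOn ℝ ∞ Ξ U
  smooth_η : ContDiffOn ℝ ∞ η U
  Φ_Φ : ∀ y ∈ U, ∀ v, Φ y (Φ y v) = v - η y v • Ξ y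
  η_Ξ : ∀ y ∈ U, η y (Ξ y) = 1
  G_Φ_Φ : ∀ y ∈ U, ∀ v w, G y (Φ y v) (Φ y w) = -G y v w + η y v * η y w
  dη_eq : ∀ y ∈ U, ∀ u v, 1 / 2 * (fderiv ℝ η y u v - fderiv ℝ η y v u) = G y u (Φ y v)

/-- The endomorphism field `v ↦ ∇_v Ξ`. -/
def covDerivReeb (G : E → E →L[ℝ] E →L[ℝ] ℝ) (Ξ : E → E) (y : E) : E →L[ℝ] E :=
  fderiv ℝ Ξ y + (christoffel G y).flip (Ξ y)

theorem covDerivReeb_apply (G : E → E →L[ℝ] E →L[ℝ] ℝ) (Ξ : E → E) (y v : E) :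
    covDerivReeb G Ξ y v = fderiv ℝ Ξ y v + christoffel G y v (Ξ y) := rfl

/-- The covariant derivative along `Ξ` of a field `T` of endomorphisms. -/
def covDerivAlong (G : E → E →L[ℝ] E →L[ℝ] ℝ) (Ξ : E → E) (T : E → E →L[ℝ] E) (y : E) :
    E →L[ℝ] E :=
  fderiv ℝ T y (Ξ y) + christoffel G y (Ξ y) ∘L T y - T y ∘L christoffel G y (Ξ y)

theorem covDerivAlong_apply (G : E → E →L[ℝ] E →L[ℝ] ℝ) (Ξ : E → E) (T : E → E →L[ℝ] E)
    (y v : E) : covDerivAlong G Ξ T y v = fderiv ℝ T y (Ξ y) v +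
      christoffel G y (Ξ y) (T y v) - T y (christoffel G y (Ξ y) v) := rfl

/-- Half the Lie derivative of `Φ` along `Ξ`. -/
def halfLie (Φ : E → E →L[ℝ] E) (Ξ : E → E) (y : E) : E →L[ℝ] E :=
  (1 / 2 : ℝ) • (fderiv ℝ Φ y (Ξ y) - fderiv ℝ Ξ y ∘L Φ y + Φ y ∘L fderiv ℝ Ξ y)

theorem halfLie_apply (Φ : E → E →L[ℝ] E) (Ξ : E → E) (y v : E) :
    halfLie Φ Ξ y v = (1 / 2 : ℝ) •
      (fderiv ℝ Φ y (Ξ y) v - fderiv ℝ Ξ y (Φ y v) + Φ y (fderiv ℝ Ξ y v)) := rfl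

namespace IsLocalStructure

variable {G : E → E →L[ℝ] E →L[ℝ] ℝ} {Φ : E → E →L[ℝ] E} {Ξ : E → E} {η : E → E →L[ℝ] ℝ}
  {U : Set E} {y : E}

section Algebra

/-- Evaluating φ³ξ in two ways makes φξ a multiple cξ, and cφξ = φ²ξ = 0. -/
theorem Φ_Ξ (P : IsLocalStructure G Φ Ξ η U) (hy : y ∈ U) : Φ y (Ξ y) = 0 := by
  have h1 : Φ y (Φ y (Ξ y)) = 0 := by simp [P.Φ_Φ y hy, P.η_Ξ y hy]
  have h2 : Φ y (Ξ y) = η y (Φ y (Ξ y)) • Ξ y := by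
    have := P.Φ_Φ y hy (Φ y (Ξ y))
    rw [h1, map_zero] at this
    exact sub_eq_zero.1 this.symm
  have h3 : η y (Φ y (Ξ y)) • Φ y (Ξ y) = 0 := by rw [← map_smul, ← h2, h1]
  rcases smul_eq_zero.1 h3 with h | h
  · rw [h2, h, zero_smul]
  · exact h

theorem Ξ_ne_zero (P : IsLocalStructure G Φ Ξ η U) (hy : y ∈ U) : Ξ y ≠ 0 := fun h ↦ by
  simpa [h] using P.η_Ξ y hy

theorem η_Φ (P : IsLocalStructure G Φ Ξ η U) (hy : y ∈ U) (v : E) : η y (Φ y v) = 0 := by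
  have h1 := P.Φ_Φ y hy (Φ y v)
  rw [P.Φ_Φ y hy v, map_sub, map_smul, P.Φ_Ξ hy, smul_zero, sub_zero] at h1
  have h2 : η y (Φ y v) • Ξ y = 0 := by simpa using h1.symm
  exact (smul_eq_zero.1 h2).resolve_right (P.Ξ_ne_zero hy)

theorem G_Ξ (P : IsLocalStructure G Φ Ξ η U) (hy : y ∈ U) (v : E) : G y (Ξ y) v = η y v := by
  have := P.G_Φ_Φ y hy (Ξ y) v
  rw [P.Φ_Ξ hy, P.η_Ξ y hy, map_zero, zero_apply] at this
  linarith

theorem G_Φ_left (P : IsLocalStructure G Φ Ξ η U) (hy : y ∈ U) (v w : E) :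
    G y (Φ y v) w = -G y v (Φ y w) := by
  have h1 := P.G_Φ_Φ y hy (Φ y v) w
  rw [P.Φ_Φ y hy, P.η_Φ hy] at h1
  simp only [map_sub, map_smul, sub_apply, smul_apply, P.G_Ξ hy, P.η_Φ hy, smul_zero] at h1
  linarith

end Algebra

/-! ### The covariant derivative of ξ, the tensor h and the Jacobi operator -/

section Reeb

theorem hasFDerivAt_Ξ (P : IsLocalStructure G Φ Ξ η U) (hy : y ∈ U) :
    HasFDerivAt Ξ (fderiv ℝ Ξ y) y := P.smooth_Ξ.hasFDerivAt_of_isOpen P.isOpen hy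

theorem hasFDerivAt_Φ (P : IsLocalStructure G Φ Ξ η U) (hy : y ∈ U) :
    HasFDerivAt Φ (fderiv ℝ Φ y) y := P.smooth_Φ.hasFDerivAt_of_isOpen P.isOpen hy

theorem hasFDerivAt_η (P : IsLocalStructure G Φ Ξ η U) (hy : y ∈ U) :
    HasFDerivAt η (fderiv ℝ η y) y := P.smooth_η.hasFDerivAt_of_isOpen P.isOpen hy

variable [FiniteDimensional ℝ E]

theorem fderiv_Ξ (P : IsLocalStructure G Φ Ξ η U) (hy : y ∈ U) (v : E) :
    fderiv ℝ Ξ y v = covDerivReeb G Ξ y v - christoffel G y (Ξ y) v := by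
  rw [covDerivReeb_apply, P.christoffel_symm hy (Ξ y) v]
  abel

/-- Differentiate η = G(ξ, ·): in invariant form, (∇_uη)(v) = G(∇_uξ, v). -/
theorem fderiv_η (P : IsLocalStructure G Φ Ξ η U) (hy : y ∈ U) (u v : E) :
    fderiv ℝ η y u v = G y (covDerivReeb G Ξ y u) v + η y (christoffel G y u v) := by
  have := P.isOpen.hasFDerivAt_unique_of_eqOn hy ((P.hasFDerivAt_η hy).clm_apply_const v)
    (((P.hasFDerivAt hy).clm_apply (P.hasFDerivAt_Ξ hy)).clm_apply_const v)
    (fun z hz ↦ (P.G_Ξ hz v).symm)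
  have := DFunLike.congr_fun this u
  simp [P.fderiv_eq_christoffel hy] at this
  rw [this, covDerivReeb_apply, ← P.G_Ξ hy]
  simp
  ring

theorem η_covDerivReeb (P : IsLocalStructure G Φ Ξ η U) (hy : y ∈ U) (u : E) :
    η y (covDerivReeb G Ξ y u) = 0 := by
  have := P.isOpen.hasFDerivAt_unique_of_eqOn hy
    ((P.hasFDerivAt_η hy).clm_apply (P.hasFDerivAt_Ξ hy)) (hasFDerivAt_const (1 : ℝ) y)
    (fun z hz ↦ P.η_Ξ z hz)
  have := DFunLike.congr_fun this u
  simp [P.fderiv_η hy] at this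
  rw [P.symm y hy, P.G_Ξ hy] at this
  rw [covDerivReeb_apply, map_add] at this ⊢
  linarith

/-- The connection is torsion-free, so the Christoffel terms drop out of dη. This identifies the
adjoint of A as A + 2φ. -/
theorem covDerivReeb_skew (P : IsLocalStructure G Φ Ξ η U) (hy : y ∈ U) (u v : E) :
    G y (covDerivReeb G Ξ y u) v - G y (covDerivReeb G Ξ y v) u = 2 * G y u (Φ y v) := by
  have := P.dη_eq y hy u v
  rw [P.fderiv_η hy, P.fderiv_η hy, P.christoffel_symm hy u v] at this
  linarith

theorem covDerivReeb_Ξ (P : IsLocalStructure G Φ Ξ η U) (hy : y ∈ U) :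
    covDerivReeb G Ξ y (Ξ y) = 0 := by
  refine P.eq_of_forall hy fun v ↦ ?_
  have := P.covDerivReeb_skew hy (Ξ y) v
  rw [P.symm y hy _ (Ξ y), P.G_Ξ hy, P.G_Ξ hy, P.η_covDerivReeb hy, P.η_Φ hy] at this
  rw [map_zero, zero_apply]
  linarith

theorem fderiv_Ξ_Ξ (P : IsLocalStructure G Φ Ξ η U) (hy : y ∈ U) :
    fderiv ℝ Ξ y (Ξ y) = -christoffel G y (Ξ y) (Ξ y) := by
  rw [P.fderiv_Ξ hy, P.covDerivReeb_Ξ hy, zero_sub]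

omit [FiniteDimensional ℝ E] in
theorem fderiv_dη (P : IsLocalStructure G Φ Ξ η U) (hy : y ∈ U) (s u v : E) :
    1 / 2 * (fderiv ℝ (fderiv ℝ η) y s u v - fderiv ℝ (fderiv ℝ η) y s v u) =
      fderiv ℝ G y s u (Φ y v) + G y u (fderiv ℝ Φ y s v) := by
  have hd : HasFDerivAt (fderiv ℝ η) (fderiv ℝ (fderiv ℝ η) y) y :=
    ContDiffOn.hasFDerivAt_of_isOpen P.isOpen (P.smooth_η.fderiv_of_isOpen P.isOpen (by simp)) hy
  have := P.isOpen.hasFDerivAt_unique_of_eqOn hy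
    ((((hd.clm_apply_const u).clm_apply_const v).sub
      ((hd.clm_apply_const v).clm_apply_const u)).const_mul (1 / 2))
    (((P.hasFDerivAt hy).clm_apply_const u).clm_apply ((P.hasFDerivAt_Φ hy).clm_apply_const v))
    (fun z hz ↦ P.dη_eq z hz u v)
  have := DFunLike.congr_fun this s
  simp at this
  linarith

omit [FiniteDimensional ℝ E] in
/-- The Lie derivative of `dη` along `Ξ` vanishes. -/
theorem lie_dη (P : IsLocalStructure G Φ Ξ η U) (hy : y ∈ U) (u v : E) :
    fderiv ℝ G y (Ξ y) u (Φ y v) + G y u (fderiv ℝ Φ y (Ξ y) v) =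
      G y v (Φ y (fderiv ℝ Ξ y u)) + G y (fderiv ℝ Ξ y v) (Φ y u) := by
  -- The cyclic sum of these three is d(dη) = 0, by symmetry of the second derivative of η. The
  -- terms `h4` and `h5` below are the derivatives of φξ = 0 and ι_ξ dη = 0.
  have h1 := P.fderiv_dη hy (Ξ y) u v
  have h2 := P.fderiv_dη hy u v (Ξ y)
  have h3 := P.fderiv_dη hy v (Ξ y) u
  rw [P.smooth_η.fderiv_fderiv_comm P.isOpen hy (Ξ y) u,
    P.smooth_η.fderiv_fderiv_comm P.isOpen hy (Ξ y) v] at h1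
  rw [P.smooth_η.fderiv_fderiv_comm P.isOpen hy u v] at h2
  have h4 := DFunLike.congr_fun (P.isOpen.hasFDerivAt_unique_of_eqOn hy
    ((P.hasFDerivAt_Φ hy).clm_apply (P.hasFDerivAt_Ξ hy)) (hasFDerivAt_const (0 : E) y)
    (fun z hz ↦ P.Φ_Ξ hz)) u
  have h5 := DFunLike.congr_fun (P.isOpen.hasFDerivAt_unique_of_eqOn hy
    (((P.hasFDerivAt hy).clm_apply (P.hasFDerivAt_Ξ hy)).clm_apply
      ((P.hasFDerivAt_Φ hy).clm_apply_const u)) (hasFDerivAt_const (0 : ℝ) y)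
    (fun z hz ↦ by rw [P.G_Ξ hz, P.η_Φ hz])) v
  simp at h4 h5
  rw [P.Φ_Ξ hy, map_zero, zero_add, ← neg_eq_of_add_eq_zero_right h4, map_neg] at h2
  linarith

/-- This is L_ξ dη = 0 written with ∇ instead of ∂, the adjoint of A being eliminated by
`covDerivReeb_skew`. -/
theorem covDerivAlong_Φ_eq (P : IsLocalStructure G Φ Ξ η U) (hy : y ∈ U) (v : E) :
    covDerivAlong G Ξ Φ y v = -(covDerivReeb G Ξ y (Φ y v) + Φ y (covDerivReeb G Ξ y v)
      + (2 : ℝ) • Φ y (Φ y v)) := by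
  refine P.eq_of_forall hy fun u ↦ ?_
  have h := P.lie_dη hy u v
  rw [P.fderiv_eq_christoffel hy, P.fderiv_Ξ hy, P.fderiv_Ξ hy] at h
  have h1 := P.covDerivReeb_skew hy u (Φ y v)
  have h2 := P.G_Φ_left hy v (covDerivReeb G Ξ y u)
  have h3 := P.G_Φ_left hy (covDerivReeb G Ξ y v) u
  have h4 := P.G_Φ_left hy v (christoffel G y (Ξ y) u)
  have h5 := P.G_Φ_left hy (christoffel G y (Ξ y) v) u
  have h6 := P.symm y hy (Φ y v) (covDerivReeb G Ξ y u)
  have h7 := P.symm y hy (Φ y u) (covDerivReeb G Ξ y v)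
  have h8 := P.symm y hy (Φ y v) (christoffel G y (Ξ y) u)
  have h9 := P.symm y hy (Φ y (Φ y v)) u
  rw [P.symm y hy u, P.symm y hy u] at h
  simp only [covDerivAlong_apply, map_add, map_sub, map_neg, map_smul, add_apply, sub_apply,
    neg_apply, smul_apply, smul_eq_mul] at *
  linarith

/-- Differentiate φ² = I − η⊗ξ along ξ; ∇_ξ(η⊗ξ) = 0 because ∇_ξξ = 0. -/
theorem covDerivAlong_Φ_anticomm (P : IsLocalStructure G Φ Ξ η U) (hy : y ∈ U) (v : E) :
    covDerivAlong G Ξ Φ y (Φ y v) + Φ y (covDerivAlong G Ξ Φ y v) = 0 := by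
  have h := DFunLike.congr_fun (P.isOpen.hasFDerivAt_unique_of_eqOn hy
    ((P.hasFDerivAt_Φ hy).clm_apply ((P.hasFDerivAt_Φ hy).clm_apply_const v))
    ((hasFDerivAt_const v y).sub
      (((P.hasFDerivAt_η hy).clm_apply_const v).smul (P.hasFDerivAt_Ξ hy)))
    (fun z hz ↦ P.Φ_Φ z hz v)) (Ξ y)
  simp [P.fderiv_η hy, P.covDerivReeb_Ξ hy, P.fderiv_Ξ_Ξ hy] at h
  simp only [covDerivAlong_apply, map_add, map_sub, P.Φ_Φ y hy, map_smul]
  linear_combination (norm := module) h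

/-- Let B = Aφ + φA + 2φ², so ∇_ξφ = −B anticommutes with φ. From Aξ = 0 and ηA = 0 one gets Aφ² = A
= φ²A, so B also commutes with φ. Hence Bφ = 0, and Bξ = 0 gives B = Bφ² = 0. -/
theorem covDerivReeb_anticomm (P : IsLocalStructure G Φ Ξ η U) (hy : y ∈ U) (v : E) :
    covDerivReeb G Ξ y (Φ y v) + Φ y (covDerivReeb G Ξ y v) + (2 : ℝ) • Φ y (Φ y v) = 0 := by
  have h := P.covDerivAlong_Φ_anticomm hy (Φ y v)
  simp only [P.covDerivAlong_Φ_eq hy, map_add, map_neg, map_smul, map_sub, P.Φ_Φ y hy,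
    P.covDerivReeb_Ξ hy, P.η_covDerivReeb hy, P.Φ_Ξ hy, zero_smul, smul_zero,
    sub_zero] at h
  rw [P.Φ_Φ y hy]
  linear_combination (norm := module) (-1 / 2 : ℝ) • h

theorem covDerivAlong_Φ (P : IsLocalStructure G Φ Ξ η U) (hy : y ∈ U) :
    covDerivAlong G Ξ Φ y = 0 := by
  ext v
  rw [P.covDerivAlong_Φ_eq hy, P.covDerivReeb_anticomm hy, neg_zero, zero_apply]

theorem fderiv_Φ_Ξ (P : IsLocalStructure G Φ Ξ η U) (hy : y ∈ U) (v : E) :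
    fderiv ℝ Φ y (Ξ y) v =
      Φ y (christoffel G y (Ξ y) v) - christoffel G y (Ξ y) (Φ y v) := by
  have := DFunLike.congr_fun (P.covDerivAlong_Φ hy) v
  rw [covDerivAlong_apply, zero_apply] at this
  rw [← sub_eq_zero, ← this]
  abel

/-- L_ξφ = ∇_ξφ − Aφ + φA, with ∇_ξφ = 0 and Aφ = −φA − 2φ². -/
theorem halfLie_eq (P : IsLocalStructure G Φ Ξ η U) (hy : y ∈ U) (v : E) :
    halfLie Φ Ξ y v = Φ y (covDerivReeb G Ξ y v) + Φ y (Φ y v) := by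
  have := P.covDerivReeb_anticomm hy v
  rw [halfLie_apply, P.fderiv_Φ_Ξ hy, P.fderiv_Ξ hy, P.fderiv_Ξ hy,
    map_sub, eq_neg_of_add_eq_zero_left (a := covDerivReeb G Ξ y (Φ y v))
      (b := Φ y (covDerivReeb G Ξ y v) + (2 : ℝ) • Φ y (Φ y v)) (by rw [← this]; abel)]
  module

theorem halfLie_Ξ (P : IsLocalStructure G Φ Ξ η U) (hy : y ∈ U) : halfLie Φ Ξ y (Ξ y) = 0 := by
  simp [P.halfLie_eq hy, P.covDerivReeb_Ξ hy, P.Φ_Ξ hy]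

theorem η_halfLie (P : IsLocalStructure G Φ Ξ η U) (hy : y ∈ U) (v : E) :
    η y (halfLie Φ Ξ y v) = 0 := by
  simp [P.halfLie_eq hy, P.η_Φ hy]

theorem covDerivReeb_eq (P : IsLocalStructure G Φ Ξ η U) (hy : y ∈ U) (v : E) :
    covDerivReeb G Ξ y v = Φ y (halfLie Φ Ξ y v) - Φ y v := by
  simp [P.halfLie_eq hy, P.Φ_Φ y hy, P.η_covDerivReeb hy, P.Φ_Ξ hy]

theorem halfLie_anticomm (P : IsLocalStructure G Φ Ξ η U) (hy : y ∈ U) (v : E) :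
    halfLie Φ Ξ y (Φ y v) + Φ y (halfLie Φ Ξ y v) = 0 := by
  have := congrArg (Φ y) (P.covDerivReeb_anticomm hy v)
  simp only [map_add, map_smul, map_zero] at this
  rw [P.halfLie_eq hy, P.halfLie_eq hy, map_add, ← this]
  module

theorem covDerivReeb_covDerivReeb (P : IsLocalStructure G Φ Ξ η U) (hy : y ∈ U) (v : E) :
    covDerivReeb G Ξ y (covDerivReeb G Ξ y v) =
      Φ y (Φ y v) - halfLie Φ Ξ y (halfLie Φ Ξ y v) := by
  have h (w : E) : halfLie Φ Ξ y (Φ y w) = -Φ y (halfLie Φ Ξ y w) :=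
    eq_neg_of_add_eq_zero_left (P.halfLie_anticomm hy w)
  simp only [P.covDerivReeb_eq hy, map_sub, h, map_neg, P.Φ_Φ y hy, P.η_halfLie hy, zero_smul,
    sub_zero]
  abel

omit [FiniteDimensional ℝ E] in
theorem smooth_halfLie (P : IsLocalStructure G Φ Ξ η U) :
    ContDiffOn ℝ ∞ (halfLie Φ Ξ) U := by
  have h1 : ContDiffOn ℝ ∞ (fderiv ℝ Φ) U := P.smooth_Φ.fderiv_of_isOpen P.isOpen (by simp)
  have h2 : ContDiffOn ℝ ∞ (fderiv ℝ Ξ) U := P.smooth_Ξ.fderiv_of_isOpen P.isOpen (by simp)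
  exact ContDiffOn.const_smul (1 / 2 : ℝ) (((h1.clm_apply P.smooth_Ξ).sub
    (h2.clm_comp P.smooth_Φ)).add (P.smooth_Φ.clm_comp h2))

omit [FiniteDimensional ℝ E] in
theorem hasFDerivAt_halfLie (P : IsLocalStructure G Φ Ξ η U) (hy : y ∈ U) :
    HasFDerivAt (halfLie Φ Ξ) (fderiv ℝ (halfLie Φ Ξ) y) y :=
  P.smooth_halfLie.hasFDerivAt_of_isOpen P.isOpen hy

theorem covDerivAlong_halfLie_anticomm (P : IsLocalStructure G Φ Ξ η U) (hy : y ∈ U) (v : E) :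
    covDerivAlong G Ξ (halfLie Φ Ξ) y (Φ y v) + Φ y (covDerivAlong G Ξ (halfLie Φ Ξ) y v) = 0 := by
  have h := DFunLike.congr_fun (P.isOpen.hasFDerivAt_unique_of_eqOn hy
    (((P.hasFDerivAt_halfLie hy).clm_apply ((P.hasFDerivAt_Φ hy).clm_apply_const v)).add
    ((P.hasFDerivAt_Φ hy).clm_apply ((P.hasFDerivAt_halfLie hy).clm_apply_const v)))
    (hasFDerivAt_const (0 : E) y) (fun z hz ↦ P.halfLie_anticomm hz v)) (Ξ y)
  have h1 := congrArg (christoffel G y (Ξ y)) (P.halfLie_anticomm hy v)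
  have h2 := P.halfLie_anticomm hy (christoffel G y (Ξ y) v)
  simp [P.fderiv_Φ_Ξ hy] at h h1
  simp only [covDerivAlong_apply, map_add, map_sub]
  linear_combination (norm := module) h + h1 - h2

theorem covDerivAlong_halfLie_Ξ (P : IsLocalStructure G Φ Ξ η U) (hy : y ∈ U) :
    covDerivAlong G Ξ (halfLie Φ Ξ) y (Ξ y) = 0 := by
  have h := DFunLike.congr_fun (P.isOpen.hasFDerivAt_unique_of_eqOn hy
    ((P.hasFDerivAt_halfLie hy).clm_apply (P.hasFDerivAt_Ξ hy))
    (hasFDerivAt_const (0 : E) y) (fun z hz ↦ P.halfLie_Ξ hz)) (Ξ y)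
  simp [P.fderiv_Ξ_Ξ hy] at h
  rw [covDerivAlong_apply, P.halfLie_Ξ hy, map_zero]
  linear_combination (norm := module) h

/-- The Jacobi operator of the Reeb field. -/
theorem localCurvature_Ξ_Ξ (P : IsLocalStructure G Φ Ξ η U) (hy : y ∈ U) (v : E) :
    localCurvature G y v (Ξ y) (Ξ y) = halfLie Φ Ξ y (halfLie Φ Ξ y v) - Φ y (Φ y v)
      - Φ y (covDerivAlong G Ξ (halfLie Φ Ξ) y v) := by
  have hd : HasFDerivAt (fderiv ℝ Ξ) (fderiv ℝ (fderiv ℝ Ξ) y) y :=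
    ContDiffOn.hasFDerivAt_of_isOpen P.isOpen (P.smooth_Ξ.fderiv_of_isOpen P.isOpen (by simp)) hy
  have hΞ := P.hasFDerivAt_Ξ hy
  have hΓ := P.hasFDerivAt_christoffel hy
  -- Differentiate A = φh − φ along ξ and Aξ = 0 along v. In the difference the second derivatives
  -- of ξ cancel, leaving R(v,ξ)ξ = −(∇_ξA)v − A²v with ∇_ξA = φ∇_ξh.
  have h1 := DFunLike.congr_fun (P.isOpen.hasFDerivAt_unique_of_eqOn hy
    ((hd.clm_apply_const v).add ((hΓ.clm_apply_const v).clm_apply hΞ))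
    (((P.hasFDerivAt_Φ hy).clm_apply ((P.hasFDerivAt_halfLie hy).clm_apply_const v)).sub
      ((P.hasFDerivAt_Φ hy).clm_apply_const v))
    (fun z hz ↦ P.covDerivReeb_eq hz v)) (Ξ y)
  have h2 := DFunLike.congr_fun (P.isOpen.hasFDerivAt_unique_of_eqOn hy
    ((hd.clm_apply hΞ).add ((hΓ.clm_apply hΞ).clm_apply hΞ))
    (hasFDerivAt_const (0 : E) y) (fun z hz ↦ P.covDerivReeb_Ξ hz)) v
  have h3 := P.covDerivReeb_covDerivReeb hy v
  have h4 := congrArg (christoffel G y (Ξ y)) (P.covDerivReeb_eq hy v)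
  have h5 := P.covDerivReeb_eq hy (christoffel G y (Ξ y) v)
  simp [P.fderiv_Φ_Ξ hy, P.fderiv_Ξ_Ξ hy] at h1 h2
  rw [P.smooth_Ξ.fderiv_fderiv_comm P.isOpen hy] at h1
  rw [covDerivAlong_apply, localCurvature_apply]
  simp only [covDerivReeb_apply, P.christoffel_symm hy (Ξ y) v, map_add,
    map_sub] at h1 h3 h4 h5 ⊢
  linear_combination (norm := module) h2 - h1 - h3 - h4 + h5

/-- With K = ∇_ξh, the relations Kφ = −φK and Kξ = 0 turn the commutator lφ − φl into 2φ²K = 2K. -/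
theorem covDerivAlong_halfLie_eq_zero (P : IsLocalStructure G Φ Ξ η U) (hy : y ∈ U)
    (hl : ∀ v, localCurvature G y (Φ y v) (Ξ y) (Ξ y) = Φ y (localCurvature G y v (Ξ y) (Ξ y))) :
    covDerivAlong G Ξ (halfLie Φ Ξ) y = 0 := by
  have hK := P.covDerivAlong_halfLie_anticomm hy
  have hh := P.halfLie_anticomm hy
  ext v
  have h1 := hl v
  have h2 := hh (halfLie Φ Ξ y v)
  have h3 := congrArg (halfLie Φ Ξ y) (hh v)
  have h4 := congrArg (Φ y) (hK v)
  have h5 := hK (Φ y v)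
  simp only [P.localCurvature_Ξ_Ξ hy, map_sub, map_add, map_zero] at h1 h3 h4
  rw [P.Φ_Φ y hy v, map_sub, map_smul, P.covDerivAlong_halfLie_Ξ hy, smul_zero, sub_zero] at h5
  rw [zero_apply]
  linear_combination (norm := module) h5 + (1 / 2 : ℝ) • (h1 - h3 + h2 - h4)

end Reeb

end IsLocalStructure

end Paracontact

/-! ### Traces in orthogonal bases and traces of squares -/

section Trace

theorem LinearMap.trace_eq_sum_of_orthogonal {ι V : Type*} [Fintype ι] [AddCommGroup V]
    [Module ℝ V] (b : Module.Basis ι ℝ V) (B : V →ₗ[ℝ] V →ₗ[ℝ] ℝ)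
    (hB : ∀ i j, i ≠ j → B (b i) (b j) = 0) (hb : ∀ i, B (b i) (b i) ≠ 0) (f : V →ₗ[ℝ] V) :
    LinearMap.trace ℝ V f = ∑ i, B (f (b i)) (b i) / B (b i) (b i) := by
  classical
  rw [LinearMap.trace_eq_matrix_trace ℝ b, Matrix.trace]
  refine Finset.sum_congr rfl fun i _ ↦ ?_
  rw [Matrix.diag_apply, LinearMap.toMatrix_apply, eq_div_iff (hb i)]
  conv_rhs => rw [← b.sum_repr (f (b i))]
  rw [map_sum, LinearMap.sum_apply, Finset.sum_eq_single i]
  · simp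
  · intro j _ hj
    simp [hB j i hj]
  · simp

variable {E : Type*} [NormedAddCommGroup E] [NormedSpace ℝ E] [FiniteDimensional ℝ E]

/-- If `∇_u T = 0`, then the derivative of `Tr T²` along `u` vanishes. -/
theorem exists_hasFDerivAt_trace_comp_self {T : E → E →L[ℝ] E} {T' : E →L[ℝ] E →L[ℝ] E} {y u : E}
    (hT : HasFDerivAt T T' y) {C : E →L[ℝ] E} (hC : T' u + C ∘L T y - T y ∘L C = 0) :
    ∃ L : E →L[ℝ] ℝ, HasFDerivAt
      (fun z ↦ LinearMap.trace ℝ E ((T z ∘L T z : E →L[ℝ] E) : E →ₗ[ℝ] E)) L y ∧ L u = 0 := by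
  let tr : (E →L[ℝ] E) →L[ℝ] ℝ :=
    LinearMap.toContinuousLinearMap (LinearMap.trace ℝ E ∘ₗ ContinuousLinearMap.coeLM ℝ)
  have htr (A B : E →L[ℝ] E) : tr (A ∘L B) = tr (B ∘L A) := LinearMap.trace_mul_comm ℝ _ _
  refine ⟨_, tr.hasFDerivAt.comp y (hT.clm_comp hT), ?_⟩
  -- The derivative of T along u is the commutator [T, C], so that of Tr T² is 2 Tr(T[T, C]), which
  -- vanishes by cyclicity.
  have h : T' u = T y ∘L C - C ∘L T y := by
    rw [← sub_eq_zero, ← hC]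
    abel
  have h1 := htr (T y) (T y ∘L C)
  have h2 := htr (T y) (C ∘L T y)
  simp only [ContinuousLinearMap.comp_assoc] at h1 h2
  simp [h, ContinuousLinearMap.comp_assoc, ContinuousLinearMap.comp_sub]
  linarith

end Trace

/-! ### Dimension three: commutation of l with φ, and the trace -/

namespace Paracontact.IsLocalStructure

open PseudoRiemannian

variable {E : Type*} [NormedAddCommGroup E] [NormedSpace ℝ E]
  {G : E → E →L[ℝ] E →L[ℝ] ℝ} {Φ : E → E →L[ℝ] E} {Ξ : E → E} {η : E → E →L[ℝ] ℝ}
  {U : Set E} {y : E}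

/-- If every horizontal vector were null, polarisation would make G vanish on ker η. As ker η is
orthogonal to ξ, it would lie in the radical of G, hence be zero. -/
theorem exists_nonnull_horizontal (P : IsLocalStructure G Φ Ξ η U) (hy : y ∈ U)
    (hdim : 1 < Module.finrank ℝ E) : ∃ e, η y e = 0 ∧ G y e e ≠ 0 := by
  by_contra! hnull
  have hzero (v w : E) (hv : η y v = 0) (hw : η y w = 0) : G y v w = 0 := by
    have h := hnull (v + w) (by simp [hv, hw])
    simp only [map_add, add_apply, hnull v hv, hnull w hw, P.symm y hy w v] at h
    linarith
  have hker (v : E) (hv : η y v = 0) : v = 0 := by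
    refine P.nondegenerate y hy v fun w ↦ ?_
    have h := hzero v (Φ y (Φ y w)) hv (P.η_Φ hy _)
    rwa [P.Φ_Φ y hy, map_sub, map_smul, P.symm y hy v (Ξ y), P.G_Ξ hy, hv, smul_zero,
      sub_zero] at h
  refine absurd (finrank_le_one (Ξ y) fun w ↦ ⟨η y w, ?_⟩) (not_le.2 hdim)
  refine (sub_eq_zero.1 (hker _ ?_)).symm
  simp [P.η_Ξ y hy]

theorem exists_basis (P : IsLocalStructure G Φ Ξ η U) (hy : y ∈ U)
    (hdim : Module.finrank ℝ E = 3) : ∃ e : E, η y e = 0 ∧ G y e e ≠ 0 ∧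
      ∃ b : Module.Basis (Fin 3) ℝ E, b 0 = e ∧ b 1 = Φ y e ∧ b 2 = Ξ y := by
  obtain ⟨e, hη, he⟩ := P.exists_nonnull_horizontal hy (by omega)
  refine ⟨e, hη, he, ?_⟩
  have h1 : G y (Φ y e) e = 0 := by
    have := P.G_Φ_left hy e e
    rw [P.symm y hy e] at this
    linarith
  have hli : LinearIndependent ℝ ![e, Φ y e, Ξ y] := by
    refine Fintype.linearIndependent_iff.2 fun c hc ↦ ?_
    simp only [Fin.sum_univ_three, Matrix.cons_val] at hc
    have hc2 : c 2 = 0 := by simpa [hη, P.η_Φ hy, P.η_Ξ y hy] using congrArg (η y) hc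
    have hc0 : c 0 = 0 := by
      have := congrArg (fun w ↦ G y w e) hc
      simpa [h1, P.G_Ξ hy, hη, he] using this
    have hc1 : c 1 = 0 := by
      have := congrArg (fun w ↦ G y w (Φ y e)) hc
      simpa [hc0, hc2, P.G_Φ_Φ y hy, hη, he] using this
    intro i
    fin_cases i <;> assumption
  refine ⟨basisOfLinearIndependentOfCardEqFinrank hli (by simp [hdim]), ?_⟩
  simp

/-- The curvature of a three-dimensional structure whose Ricci form anticommutes with `Φ`, in the
sense that `Ric(Φ v, w) = -Ric(v, Φ w)`. -/
theorem localCurvature_Φ_Ξ_Ξ [FiniteDimensional ℝ E] (P : IsLocalStructure G Φ Ξ η U) (hy : y ∈ U)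
    (hdim : Module.finrank ℝ E = 3)
    (hRic : ∀ v w, LinearMap.trace ℝ E (((localCurvature G y).flip (Φ y v)).flip w) =
      -LinearMap.trace ℝ E (((localCurvature G y).flip v).flip (Φ y w))) (v : E) :
    localCurvature G y (Φ y v) (Ξ y) (Ξ y) = Φ y (localCurvature G y v (Ξ y) (Ξ y)) := by
  obtain ⟨e, hη, he, b, hb0, hb1, hb2⟩ := P.exists_basis hy hdim
  have hR := P.localCurvature_antisymm_right hy
  have hL := localCurvature_antisymm_left G y
  have h1 : G y (Φ y e) e = 0 := by
    have := P.G_Φ_left hy e e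
    rw [P.symm y hy e] at this
    linarith
  have hΦe : Φ y (Φ y e) = e := by simp [P.Φ_Φ y hy, hη]
  have hΦΦ : G y (Φ y e) (Φ y e) = -G y e e := by simp [P.G_Φ_Φ y hy, hη]
  -- The minus sign comes from G(φe,φe) = −G(e,e); the skew symmetries of R turn the ξ-term into
  -- G(lv, w).
  have htrace (v w : E) : LinearMap.trace ℝ E (((localCurvature G y).flip v).flip w) =
      G y (localCurvature G y e v w) e / G y e e
        - G y (localCurvature G y (Φ y e) v w) (Φ y e) / G y e e
        + G y (localCurvature G y v (Ξ y) (Ξ y)) w := by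
    have hΞ : G y (localCurvature G y (Ξ y) v w) (Ξ y) =
        G y (localCurvature G y v (Ξ y) (Ξ y)) w := by
      rw [hL, map_neg, neg_apply, hR, neg_neg, P.symm y hy]
    rw [LinearMap.trace_eq_sum_of_orthogonal b
      (ContinuousLinearMap.coeLM ℝ ∘ₗ (G y : E →ₗ[ℝ] E →L[ℝ] ℝ))]
    · simp [Fin.sum_univ_three, hb0, hb1, hb2, hΦΦ, P.G_Ξ hy, P.η_Ξ y hy, ← hΞ]
      ring
    · intro i j hij
      have h1' : G y e (Φ y e) = 0 := by rw [P.symm y hy, h1]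
      have h2 : G y e (Ξ y) = 0 := by rw [P.symm y hy, P.G_Ξ hy, hη]
      have h3 : G y (Φ y e) (Ξ y) = 0 := by rw [P.symm y hy, P.G_Ξ hy, P.η_Φ hy]
      fin_cases i <;> fin_cases j <;>
        simp [hb0, hb1, hb2, P.G_Ξ hy, P.η_Φ hy, hη, h1, h1', h2, h3] at hij ⊢
    · intro i
      fin_cases i <;> simp [hb0, hb1, hb2, hΦΦ, P.G_Ξ hy, P.η_Ξ y hy, he]
  have hself (s u v : E) : G y (localCurvature G y s u v) v = 0 := by
    have := hR s u v v
    rw [P.symm y hy v] at this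
    linarith
  have hdiag (u w z : E) : G y (localCurvature G y u u w) z = 0 := by
    have := congrArg (fun x ↦ G y x z) (hL u u w)
    simp only [map_neg, neg_apply] at this
    linarith
  have hcross : G y (localCurvature G y e (Φ y e) (Φ y e)) e =
      G y (localCurvature G y (Φ y e) e e) (Φ y e) := by
    rw [hL, map_neg, neg_apply, hR, neg_neg, P.symm y hy]
  -- These two instances suffice: the first gives G(lφe, e) = −G(le, φe). The second gives G(lφe,
  -- φe) = −G(le, e), since by `hcross` the planar curvature appears equally on both sides.
  have hee := hRic e e
  have heΦ := hRic e (Φ y e)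
  simp only [htrace, hΦe, hself, hdiag, hcross, zero_div] at hee heΦ
  have hΞΞ (w : E) : G y (localCurvature G y (Ξ y) (Ξ y) (Ξ y)) w = 0 := hdiag _ _ _
  have hJΞ : localCurvature G y (Ξ y) (Ξ y) (Ξ y) = 0 := P.nondegenerate y hy _ hΞΞ
  have hlin : ((((localCurvature G y).flip (Ξ y)).flip (Ξ y) ∘L Φ y : E →L[ℝ] E) : E →ₗ[ℝ] E) =
      ((Φ y ∘L ((localCurvature G y).flip (Ξ y)).flip (Ξ y) : E →L[ℝ] E) : E →ₗ[ℝ] E) := by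
    -- Both sides are compared through their G-products with the frame; every entry involving ξ
    -- vanishes because lξ = 0 and G(lv, ξ) = 0.
    refine b.ext fun i ↦ P.eq_of_forall hy fun w ↦ ?_
    rw [← ContinuousLinearMap.coe_coe, ← ContinuousLinearMap.coe_coe]
    refine LinearMap.congr_fun (b.ext fun j ↦ ?_) w
    fin_cases i <;> fin_cases j <;>
      simp [hb0, hb1, hb2, P.G_Φ_left hy, hΦe, P.Φ_Ξ hy, hself, hJΞ] <;> linarith
  exact LinearMap.congr_fun hlin v

theorem exists_hasFDerivAt_trace_sub [FiniteDimensional ℝ E] (P : IsLocalStructure G Φ Ξ η U)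
    (hy : y ∈ U) (hK : covDerivAlong G Ξ (halfLie Φ Ξ) y = 0) :
    ∃ L : E →L[ℝ] ℝ, HasFDerivAt (fun z ↦ LinearMap.trace ℝ E
      ((halfLie Φ Ξ z ∘L halfLie Φ Ξ z - Φ z ∘L Φ z : E →L[ℝ] E) : E →ₗ[ℝ] E)) L y ∧
      L (Ξ y) = 0 := by
  obtain ⟨L, hL, hLΞ⟩ := exists_hasFDerivAt_trace_comp_self (P.hasFDerivAt_halfLie hy) hK
  obtain ⟨L', hL', hLΞ'⟩ :=
    exists_hasFDerivAt_trace_comp_self (P.hasFDerivAt_Φ hy) (P.covDerivAlong_Φ hy)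
  refine ⟨L - L', ?_, by simp [hLΞ, hLΞ']⟩
  refine (hL.sub hL').congr_of_eventuallyEq (Filter.Eventually.of_forall fun z ↦ ?_)
  simp

end Paracontact.IsLocalStructure

/-! ### Reading vector fields, brackets and traces in a fixed chart -/

section Chart

open VectorField

variable {E : Type*} [NormedAddCommGroup E] [NormedSpace ℝ E]
  {M : Type*} [TopologicalSpace M] [ChartedSpace E M]

/-- The differential of the inverse of the preferred chart at `x₀`. -/
def chartSymmDeriv (x₀ : M) (y : E) :
    E →L[ℝ] TangentSpace 𝓘(ℝ, E) ((extChartAt 𝓘(ℝ, E) x₀).symm y) :=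
  mfderivWithin 𝓘(ℝ, E) 𝓘(ℝ, E) (extChartAt 𝓘(ℝ, E) x₀).symm (range 𝓘(ℝ, E)) y

/-- The differential at `x` of the preferred chart at `x₀`. -/
def chartDerivAt (x₀ x : M) : TangentSpace 𝓘(ℝ, E) x →L[ℝ] E :=
  mfderiv 𝓘(ℝ, E) 𝓘(ℝ, E) (extChartAt 𝓘(ℝ, E) x₀) x

/-- The vector field whose coordinates in the preferred chart at `x₀` are constant. -/
def constField (x₀ : M) (u : E) (x : M) : TangentSpace 𝓘(ℝ, E) x :=
  (chartDerivAt x₀ x).inverse u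

/-- A vector field read in the preferred chart at `x₀`. -/
def fieldInChart (x₀ : M) (V : Π x : M, TangentSpace 𝓘(ℝ, E) x) (y : E) : E :=
  (chartSymmDeriv x₀ y).inverse (V ((extChartAt 𝓘(ℝ, E) x₀).symm y))

theorem chartSymmDeriv_eq_mfderiv (x₀ : M) (y : E) : chartSymmDeriv x₀ y =
    mfderiv 𝓘(ℝ, E) 𝓘(ℝ, E) (extChartAt 𝓘(ℝ, E) x₀).symm y := by
  rw [chartSymmDeriv, ← mfderivWithin_univ]
  congr 1
  simp

theorem fieldInChart_eq_mpullback (x₀ : M) (V : Π x : M, TangentSpace 𝓘(ℝ, E) x) :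
    fieldInChart x₀ V = mpullback 𝓘(ℝ, E) 𝓘(ℝ, E) (extChartAt 𝓘(ℝ, E) x₀).symm V := by
  ext1 y
  rw [fieldInChart, chartSymmDeriv_eq_mfderiv]
  rfl

variable [IsManifold 𝓘(ℝ, E) ∞ M] {x₀ : M} {y : E}

theorem contMDiffAt_extChartAt_symm (hy : y ∈ (extChartAt 𝓘(ℝ, E) x₀).target) :
    ContMDiffAt 𝓘(ℝ, E) 𝓘(ℝ, E) ∞ (extChartAt 𝓘(ℝ, E) x₀).symm y :=
  (contMDiffOn_extChartAt_symm x₀).contMDiffAt ((isOpen_extChartAt_target x₀).mem_nhds hy)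

theorem contMDiffAt_extChartAt_of_mem {x : M} (hx : x ∈ (extChartAt 𝓘(ℝ, E) x₀).source) :
    ContMDiffAt 𝓘(ℝ, E) 𝓘(ℝ, E) ∞ (extChartAt 𝓘(ℝ, E) x₀) x :=
  contMDiffAt_extChartAt' (by simpa using hx)

theorem isInvertible_chartSymmDeriv (hy : y ∈ (extChartAt 𝓘(ℝ, E) x₀).target) :
    (chartSymmDeriv (E := E) x₀ y).IsInvertible :=
  isInvertible_mfderivWithin_extChartAt_symm hy

theorem isInvertible_chartDerivAt {x : M} (hx : x ∈ (extChartAt 𝓘(ℝ, E) x₀).source) :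
    (chartDerivAt (E := E) x₀ x).IsInvertible :=
  isInvertible_mfderiv_extChartAt hx

theorem chartDerivAt_eq_inverse (hy : y ∈ (extChartAt 𝓘(ℝ, E) x₀).target) :
    chartDerivAt x₀ ((extChartAt 𝓘(ℝ, E) x₀).symm y) = (chartSymmDeriv x₀ y).inverse := by
  ext v
  obtain ⟨u, rfl⟩ := (isInvertible_chartSymmDeriv hy).surjective v
  rw [(isInvertible_chartSymmDeriv hy).inverse_apply_self]
  exact DFunLike.congr_fun (mfderiv_extChartAt_comp_mfderivWithin_extChartAt_symm hy) u

theorem constField_symm (hy : y ∈ (extChartAt 𝓘(ℝ, E) x₀).target) (u : E) :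
    constField x₀ u ((extChartAt 𝓘(ℝ, E) x₀).symm y) = chartSymmDeriv x₀ y u := by
  rw [constField, chartDerivAt_eq_inverse hy, (isInvertible_chartSymmDeriv hy).inverse_inverse]

theorem chartDerivAt_apply_field {x : M} (hx : x ∈ (extChartAt 𝓘(ℝ, E) x₀).source)
    (V : Π x : M, TangentSpace 𝓘(ℝ, E) x) :
    chartDerivAt x₀ x (V x) = fieldInChart x₀ V (extChartAt 𝓘(ℝ, E) x₀ x) := by
  obtain ⟨y, hy, rfl⟩ : ∃ y ∈ (extChartAt 𝓘(ℝ, E) x₀).target,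
      (extChartAt 𝓘(ℝ, E) x₀).symm y = x :=
    ⟨_, PartialEquiv.map_source _ hx, PartialEquiv.left_inv _ hx⟩
  rw [PartialEquiv.right_inv _ hy, fieldInChart, chartDerivAt_eq_inverse hy]

theorem fieldInChart_constField (u : E) (hy : y ∈ (extChartAt 𝓘(ℝ, E) x₀).target) :
    fieldInChart x₀ (constField x₀ u) y = u := by
  rw [fieldInChart, constField_symm hy, (isInvertible_chartSymmDeriv hy).inverse_apply_self]

theorem fieldInChart_constField_eventuallyEq (u : E)
    (hy : y ∈ (extChartAt 𝓘(ℝ, E) x₀).target) :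
    fieldInChart x₀ (constField x₀ u) =ᶠ[nhds y] fun _ ↦ u :=
  Filter.eventuallyEq_of_mem ((isOpen_extChartAt_target x₀).mem_nhds hy)
    fun _ hz ↦ fieldInChart_constField u hz

theorem contDiffOn_comp_extChartAt_symm {f : M → ℝ}
    (hf : ∀ x ∈ (extChartAt 𝓘(ℝ, E) x₀).source, ContMDiffAt 𝓘(ℝ, E) 𝓘(ℝ, ℝ) ∞ f x) :
    ContDiffOn ℝ ∞ (fun y ↦ f ((extChartAt 𝓘(ℝ, E) x₀).symm y))
      (extChartAt 𝓘(ℝ, E) x₀).target := by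
  intro y hy
  refine (contMDiffAt_iff_contDiffAt.1 ?_).contDiffWithinAt
  exact (hf _ (PartialEquiv.map_target _ hy)).comp y (contMDiffAt_extChartAt_symm hy)

theorem fderiv_comp_extChartAt_symm {f : M → ℝ} (hy : y ∈ (extChartAt 𝓘(ℝ, E) x₀).target)
    (hf : MDifferentiableAt 𝓘(ℝ, E) 𝓘(ℝ, ℝ) f ((extChartAt 𝓘(ℝ, E) x₀).symm y)) (u : E) :
    fderiv ℝ (fun y ↦ f ((extChartAt 𝓘(ℝ, E) x₀).symm y)) y u =
      mvfderiv 𝓘(ℝ, E) f ((extChartAt 𝓘(ℝ, E) x₀).symm y) (chartSymmDeriv x₀ y u) := by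
  have := mvfderiv_comp y hf ((contMDiffAt_extChartAt_symm hy).mdifferentiableAt (by simp))
  rw [chartSymmDeriv_eq_mfderiv]
  have := DFunLike.congr_fun this u
  rw [← mfderiv_eq_fderiv]
  exact this

/-- The trace of an endomorphism of a tangent space may be computed in a chart. -/
theorem trace_eq_of_chartDerivAt {x : M} (hx : x ∈ (extChartAt 𝓘(ℝ, E) x₀).source)
    (A : TangentSpace 𝓘(ℝ, E) x →ₗ[ℝ] TangentSpace 𝓘(ℝ, E) x) (B : E →ₗ[ℝ] E)
    (h : ∀ v, chartDerivAt x₀ x (A v) = B (chartDerivAt x₀ x v)) :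
    LinearMap.trace ℝ (TangentSpace 𝓘(ℝ, E) x) A = LinearMap.trace ℝ E B := by
  obtain ⟨e, he⟩ := isInvertible_chartDerivAt (x₀ := x₀) hx
  rw [← LinearMap.trace_conj' A e.toLinearEquiv]
  congr 1
  ext u
  obtain ⟨v, rfl⟩ := e.surjective u
  have := h v
  rw [← he] at this
  simpa [LinearEquiv.conj_apply] using this

variable [CompleteSpace E]

theorem contMDiffAt_constField (u : E) {x : M} (hx : x ∈ (extChartAt 𝓘(ℝ, E) x₀).source) :
    CMDiffAt ∞ (T% (constField x₀ u)) x := by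
  have h : ContMDiffAt 𝓘(ℝ, E) 𝓘(ℝ, E).tangent ∞
      (fun y : E ↦ (⟨y, u⟩ : TangentBundle 𝓘(ℝ, E) E)) (extChartAt 𝓘(ℝ, E) x₀ x) :=
    contMDiffAt_vectorSpace_iff_contDiffAt.2 contDiffAt_const
  exact ContMDiffAt.mpullback_vectorField_preimage (n := ∞) h (contMDiffAt_extChartAt_of_mem hx)
    (isInvertible_mfderiv_extChartAt hx) (by simp)

theorem contDiffOn_fieldInChart {V : Π x : M, TangentSpace 𝓘(ℝ, E) x}
    (hV : ∀ x ∈ (extChartAt 𝓘(ℝ, E) x₀).source, CMDiffAt ∞ (T% V) x) :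
    ContDiffOn ℝ ∞ (fieldInChart x₀ V) (extChartAt 𝓘(ℝ, E) x₀).target := by
  intro y hy
  refine ContDiffAt.contDiffWithinAt ?_
  have hinv := isInvertible_chartSymmDeriv hy
  rw [chartSymmDeriv_eq_mfderiv] at hinv
  have := ContMDiffAt.mpullback_vectorField_preimage (n := ∞)
    (hV _ (PartialEquiv.map_target _ hy)) (contMDiffAt_extChartAt_symm hy) hinv (by simp)
  rw [fieldInChart_eq_mpullback]
  exact contMDiffAt_vectorSpace_iff_contDiffAt.1 this

/-- The Lie bracket may be computed in any chart. -/
theorem fieldInChart_mlieBracket {V W : Π x : M, TangentSpace 𝓘(ℝ, E) x}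
    (hy : y ∈ (extChartAt 𝓘(ℝ, E) x₀).target)
    (hV : MDiffAt (T% V) ((extChartAt 𝓘(ℝ, E) x₀).symm y))
    (hW : MDiffAt (T% W) ((extChartAt 𝓘(ℝ, E) x₀).symm y)) :
    fieldInChart x₀ (mlieBracket 𝓘(ℝ, E) V W) y =
      lieBracket ℝ (fieldInChart x₀ V) (fieldInChart x₀ W) y := by
  have : IsManifold 𝓘(ℝ, E) (minSmoothness ℝ 2) M := IsManifold.of_le (n := ∞) (by simp; norm_cast)
  have h := mpullback_mlieBracket hV hW (contMDiffAt_extChartAt_symm hy) (by simp; norm_cast)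
  have h' (X Y : E → E) : mlieBracket 𝓘(ℝ, E) X Y y = lieBracket ℝ X Y y :=
    (congrFun mlieBracketWithin_univ.symm y).trans
      ((congrFun mlieBracketWithin_eq_lieBracketWithin y).trans (congrFun lieBracketWithin_univ y))
  simp only [fieldInChart_eq_mpullback]
  exact h.trans (h' _ _)

/-- Meant for the argument of ∇_ξh, a vector field differentiable only at the point considered. -/
theorem differentiableAt_fieldInChart {V : Π x : M, TangentSpace 𝓘(ℝ, E) x} (x₀ : M)
    (hV : MDiffAt (T% V) x₀) :
    DifferentiableAt ℝ (fieldInChart x₀ V) (extChartAt 𝓘(ℝ, E) x₀ x₀) := by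
  have : IsManifold 𝓘(ℝ, E) 2 M := IsManifold.of_le (n := ∞) (by norm_cast)
  have h : DifferentiableWithinAt ℝ (fieldInChart x₀ V) _ _ :=
    MDifferentiableWithinAt.differentiableWithinAt_mpullbackWithin_vectorField
      (hV.mdifferentiableWithinAt (s := univ))
  exact h.differentiableAt (by simp)

end Chart

/-! ### The metric, connection and curvature in a chart -/

namespace PseudoRiemannian.Metric

variable {E : Type*} [NormedAddCommGroup E] [NormedSpace ℝ E]
  {M : Type*} [TopologicalSpace M] [ChartedSpace E M] [IsManifold 𝓘(ℝ, E) ∞ M]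
  (g : Metric E M) {x₀ : M} {y : E}

theorem inChart_apply (x₀ : M) (y u v : E) : g.inChart x₀ y u v =
    g.val ((extChartAt 𝓘(ℝ, E) x₀).symm y) (chartSymmDeriv x₀ y u) (chartSymmDeriv x₀ y v) := rfl

theorem inChart_chartDerivAt {x : M} (hx : x ∈ (extChartAt 𝓘(ℝ, E) x₀).source)
    (v w : TangentSpace 𝓘(ℝ, E) x) :
    g.inChart x₀ (extChartAt 𝓘(ℝ, E) x₀ x) (chartDerivAt x₀ x v) (chartDerivAt x₀ x w) =
      g.val x v w := by
  obtain ⟨y, hy, rfl⟩ : ∃ y ∈ (extChartAt 𝓘(ℝ, E) x₀).target,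
      (extChartAt 𝓘(ℝ, E) x₀).symm y = x :=
    ⟨_, PartialEquiv.map_source _ hx, PartialEquiv.left_inv _ hx⟩
  rw [PartialEquiv.right_inv _ hy, inChart_apply, chartDerivAt_eq_inverse hy,
    (isInvertible_chartSymmDeriv hy).self_apply_inverse,
    (isInvertible_chartSymmDeriv hy).self_apply_inverse]

theorem isLocalMetric_inChart [FiniteDimensional ℝ E] (x₀ : M) :
    IsLocalMetric (g.inChart x₀) (extChartAt 𝓘(ℝ, E) x₀).target where
  isOpen := isOpen_extChartAt_target x₀
  smooth := by
    have : CompleteSpace E := FiniteDimensional.complete ℝ E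
    refine contDiffOn_clm_apply.2 fun u ↦ contDiffOn_clm_apply.2 fun v ↦ ?_
    -- The matrix entries of the local metric are the values of g on fields with constant
    -- coordinates.
    have h : ∀ x ∈ (extChartAt 𝓘(ℝ, E) x₀).source, ContMDiffAt 𝓘(ℝ, E) 𝓘(ℝ, ℝ) ∞
        (fun x ↦ g.val x (constField x₀ u x) (constField x₀ v x)) x := fun x hx ↦ by
      have h1 := ContMDiffAt.clm_bundle_apply₂ (F₁ := E) (F₂ := E) (F₃ := ℝ)
        (E₃ := Bundle.Trivial M ℝ) (g.contMDiff x)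
        (contMDiffAt_constField u hx) (contMDiffAt_constField v hx)
      exact (Bundle.contMDiffAt_totalSpace.1 h1).2
    refine (contDiffOn_comp_extChartAt_symm h).congr fun y hy ↦ ?_
    rw [inChart_apply, constField_symm hy, constField_symm hy]
  symm y _ v w := g.symm _ _ _
  nondegenerate y hy v hv := by
    have hD := isInvertible_chartSymmDeriv hy
    refine hD.injective ((g.nondegenerate _ _ fun w ↦ ?_).trans (map_zero _).symm)
    obtain ⟨u, rfl⟩ := hD.surjective w
    exact hv u

omit [IsManifold 𝓘(ℝ, E) ∞ M] in
theorem chartDeriv_eq (x : M) : chartDeriv (E := E) x = chartDerivAt x x := rfl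

theorem isInvertible_chartDeriv (x : M) : (chartDeriv (E := E) x).IsInvertible :=
  isInvertible_chartDerivAt (mem_extChartAt_source x)

theorem chartDeriv_curvature (x : M) (u v w : TangentSpace 𝓘(ℝ, E) x) :
    chartDeriv x (g.curvature x u v w) =
      localCurvature (g.inChart x) (extChartAt 𝓘(ℝ, E) x x)
        (chartDeriv x u) (chartDeriv x v) (chartDeriv x w) :=
  (isInvertible_chartDeriv x).self_apply_inverse _

theorem chartDeriv_leviCivita (Y : Π x : M, TangentSpace 𝓘(ℝ, E) x) (x : M)
    (v : TangentSpace 𝓘(ℝ, E) x) :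
    chartDeriv x (g.leviCivita Y x v) =
      fderiv ℝ (fieldInChart x Y) (extChartAt 𝓘(ℝ, E) x x) (chartDeriv x v)
        + christoffel (g.inChart x) (extChartAt 𝓘(ℝ, E) x x) (chartDeriv x v)
          (chartDeriv x (Y x)) := by
  rw [chartDeriv_eq, chartDerivAt_apply_field (mem_extChartAt_source x)]
  exact (isInvertible_chartDeriv x).self_apply_inverse _

theorem ricci_eq (x : M) (v w : TangentSpace 𝓘(ℝ, E) x) :
    g.ricci x v w = LinearMap.trace ℝ E
      (((localCurvature (g.inChart x) (extChartAt 𝓘(ℝ, E) x x)).flip (chartDeriv x v)).flip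
        (chartDeriv x w)) :=
  trace_eq_of_chartDerivAt (mem_extChartAt_source x) _ _ fun u ↦ g.chartDeriv_curvature x u v w

theorem val_ricciOperator [FiniteDimensional ℝ E] (x : M) (v w : TangentSpace 𝓘(ℝ, E) x) :
    g.val x (g.ricciOperator x v) w = g.ricci x v w := by
  have h : (g.val x).IsInvertible :=
    isInvertible_of_nondegenerate (E := E) (B := g.val x) (g.nondegenerate x)
  rw [ricciOperator, h.self_apply_inverse]
  rfl

end PseudoRiemannian.Metric

/-! ### The paracontact structure in a chart -/

namespace Paracontact.MetricStructure

open PseudoRiemannian VectorField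

variable {E : Type*} [NormedAddCommGroup E] [NormedSpace ℝ E]
  {M : Type*} [TopologicalSpace M] [ChartedSpace E M] [IsManifold 𝓘(ℝ, E) ∞ M]
  (P : MetricStructure E M) {x₀ x : M} {y : E}

/-- The tensor field `φ` read in the preferred chart at `x₀`. -/
def φInChart (x₀ : M) (y : E) : E →L[ℝ] E :=
  (chartSymmDeriv x₀ y).inverse ∘L P.φ ((extChartAt 𝓘(ℝ, E) x₀).symm y) ∘L chartSymmDeriv x₀ y

/-- The contact form read in the preferred chart at `x₀`. -/
def ηInChart (x₀ : M) (y : E) : E →L[ℝ] ℝ :=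
  P.η ((extChartAt 𝓘(ℝ, E) x₀).symm y) ∘L chartSymmDeriv x₀ y

theorem chartSymmDeriv_φInChart (hy : y ∈ (extChartAt 𝓘(ℝ, E) x₀).target) (u : E) :
    chartSymmDeriv x₀ y (P.φInChart x₀ y u) =
      P.φ ((extChartAt 𝓘(ℝ, E) x₀).symm y) (chartSymmDeriv x₀ y u) :=
  (isInvertible_chartSymmDeriv hy).self_apply_inverse _

theorem chartSymmDeriv_ξ (hy : y ∈ (extChartAt 𝓘(ℝ, E) x₀).target) :
    chartSymmDeriv x₀ y (fieldInChart x₀ P.ξ y) = P.ξ ((extChartAt 𝓘(ℝ, E) x₀).symm y) :=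
  (isInvertible_chartSymmDeriv hy).self_apply_inverse _

theorem fieldInChart_φ (Y : Π x : M, TangentSpace 𝓘(ℝ, E) x)
    (hy : y ∈ (extChartAt 𝓘(ℝ, E) x₀).target) :
    fieldInChart x₀ (fun x ↦ P.φ x (Y x)) y = P.φInChart x₀ y (fieldInChart x₀ Y y) := by
  refine (isInvertible_chartSymmDeriv hy).injective ?_
  rw [P.chartSymmDeriv_φInChart hy, fieldInChart, fieldInChart,
    (isInvertible_chartSymmDeriv hy).self_apply_inverse,
    (isInvertible_chartSymmDeriv hy).self_apply_inverse]

theorem chartDerivAt_φ (hx : x ∈ (extChartAt 𝓘(ℝ, E) x₀).source) (v : TangentSpace 𝓘(ℝ, E) x) :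
    chartDerivAt x₀ x (P.φ x v) =
      P.φInChart x₀ (extChartAt 𝓘(ℝ, E) x₀ x) (chartDerivAt x₀ x v) := by
  obtain ⟨y, hy, rfl⟩ : ∃ y ∈ (extChartAt 𝓘(ℝ, E) x₀).target,
      (extChartAt 𝓘(ℝ, E) x₀).symm y = x :=
    ⟨_, PartialEquiv.map_source _ hx, PartialEquiv.left_inv _ hx⟩
  obtain ⟨u, rfl⟩ := (isInvertible_chartSymmDeriv hy).surjective v
  rw [PartialEquiv.right_inv _ hy, chartDerivAt_eq_inverse hy, ← P.chartSymmDeriv_φInChart hy,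
    (isInvertible_chartSymmDeriv hy).inverse_apply_self,
    (isInvertible_chartSymmDeriv hy).inverse_apply_self]

variable [FiniteDimensional ℝ E]

theorem mdifferentiableAt_constField (u : E) (hx : x ∈ (extChartAt 𝓘(ℝ, E) x₀).source) :
    MDiffAt (T% (constField x₀ u)) x :=
  have : CompleteSpace E := FiniteDimensional.complete ℝ E
  (contMDiffAt_constField u hx).mdifferentiableAt (by simp)

theorem contMDiffAt_η_constField (u : E) (hx : x ∈ (extChartAt 𝓘(ℝ, E) x₀).source) :
    ContMDiffAt 𝓘(ℝ, E) 𝓘(ℝ, ℝ) ∞ (fun x ↦ P.η x (constField x₀ u x)) x := by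
  have : CompleteSpace E := FiniteDimensional.complete ℝ E
  have h := ContMDiffAt.clm_bundle_apply (F₁ := E) (F₂ := ℝ) (E₂ := Bundle.Trivial M ℝ)
    (P.contMDiff_η x) (contMDiffAt_constField u hx)
  exact (Bundle.contMDiffAt_totalSpace.1 h).2

theorem fderiv_ηInChart (hy : y ∈ (extChartAt 𝓘(ℝ, E) x₀).target) (u v : E) :
    fderiv ℝ (fun z ↦ P.ηInChart x₀ z v) y u =
      mvfderiv 𝓘(ℝ, E) (fun x ↦ P.η x (constField x₀ v x)) ((extChartAt 𝓘(ℝ, E) x₀).symm y)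
        (constField x₀ u ((extChartAt 𝓘(ℝ, E) x₀).symm y)) := by
  rw [constField_symm hy, ← fderiv_comp_extChartAt_symm hy
    ((P.contMDiffAt_η_constField v (PartialEquiv.map_target _ hy)).mdifferentiableAt (by simp))]
  refine congrArg (fun A : E →L[ℝ] ℝ ↦ A u) (Filter.EventuallyEq.fderiv_eq ?_)
  filter_upwards [(isOpen_extChartAt_target x₀).mem_nhds hy] with z hz
  rw [constField_symm hz]
  rfl

/-- On these fields the bracket term of dη disappears, which leaves the coordinate formula of
`IsLocalStructure.dη_eq`. -/
theorem mlieBracket_constField (hy : y ∈ (extChartAt 𝓘(ℝ, E) x₀).target) (u v : E) :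
    mlieBracket 𝓘(ℝ, E) (constField x₀ u) (constField x₀ v)
      ((extChartAt 𝓘(ℝ, E) x₀).symm y) = 0 := by
  have : CompleteSpace E := FiniteDimensional.complete ℝ E
  have hx := PartialEquiv.map_target _ hy
  have h := fieldInChart_mlieBracket hy (mdifferentiableAt_constField u hx)
    (mdifferentiableAt_constField v hx)
  rw [lieBracket_eq] at h
  simp only [(fieldInChart_constField_eventuallyEq u hy).fderiv_eq,
    (fieldInChart_constField_eventuallyEq v hy).fderiv_eq, fderiv_fun_const, Pi.zero_apply,
    zero_apply, sub_zero] at h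
  have h' := congrArg (chartSymmDeriv x₀ y) h
  rwa [fieldInChart, (isInvertible_chartSymmDeriv hy).self_apply_inverse, map_zero] at h'

theorem isLocalStructure (x₀ : M) :
    IsLocalStructure (P.g.inChart x₀) (P.φInChart x₀) (fieldInChart x₀ P.ξ) (P.ηInChart x₀)
      (extChartAt 𝓘(ℝ, E) x₀).target := by
  have : CompleteSpace E := FiniteDimensional.complete ℝ E
  have hηsmooth : ContDiffOn ℝ ∞ (P.ηInChart x₀) (extChartAt 𝓘(ℝ, E) x₀).target := by
    refine contDiffOn_clm_apply.2 fun u ↦ ?_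
    refine (contDiffOn_comp_extChartAt_symm fun x hx ↦ P.contMDiffAt_η_constField u hx).congr
      fun y hy ↦ ?_
    rw [constField_symm hy]
    rfl
  refine { P.g.isLocalMetric_inChart x₀ with
    smooth_Φ := ?_, smooth_Ξ := ?_, smooth_η := hηsmooth, Φ_Φ := ?_, η_Ξ := ?_, G_Φ_Φ := ?_,
    dη_eq := ?_ }
  · refine contDiffOn_clm_apply.2 fun u ↦ ?_
    have h : ∀ x ∈ (extChartAt 𝓘(ℝ, E) x₀).source,
        CMDiffAt ∞ (T% (fun x ↦ P.φ x (constField x₀ u x))) x := fun x hx ↦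
      ContMDiffAt.clm_bundle_apply (F₁ := E) (F₂ := E) (P.contMDiff_φ x)
        (contMDiffAt_constField u hx)
    refine (contDiffOn_fieldInChart h).congr fun y hy ↦ ?_
    rw [P.fieldInChart_φ _ hy, fieldInChart_constField u hy]
  · exact contDiffOn_fieldInChart fun x _ ↦ P.contMDiff_ξ x
  · intro y hy v
    refine (isInvertible_chartSymmDeriv hy).injective ?_
    rw [P.chartSymmDeriv_φInChart hy, P.chartSymmDeriv_φInChart hy, P.φ_φ, map_sub, map_smul,
      P.chartSymmDeriv_ξ hy]
    rfl
  · intro y hy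
    refine (congrArg (P.η _) (P.chartSymmDeriv_ξ hy)).trans (P.η_ξ _)
  · intro y hy v w
    rw [Metric.inChart_apply, P.chartSymmDeriv_φInChart hy, P.chartSymmDeriv_φInChart hy, P.g_φ_φ]
    rfl
  · intro y hy u v
    have hx := PartialEquiv.map_target _ hy
    have hd := ContDiffOn.hasFDerivAt_of_isOpen (isOpen_extChartAt_target x₀) hηsmooth hy
    have h := P.dη_eq _ _ _ (mdifferentiableAt_constField u hx) (mdifferentiableAt_constField v hx)
    rw [mlieBracket_constField hy, map_zero, sub_zero, ← P.fderiv_ηInChart hy,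
      ← P.fderiv_ηInChart hy, (hd.clm_apply_const u).fderiv, (hd.clm_apply_const v).fderiv,
      constField_symm hy, constField_symm hy] at h
    rw [Metric.inChart_apply, P.chartSymmDeriv_φInChart hy]
    exact h

theorem chartSymmDeriv_halfLie (hy : y ∈ (extChartAt 𝓘(ℝ, E) x₀).target) (u : E) :
    chartSymmDeriv x₀ y (halfLie (P.φInChart x₀) (fieldInChart x₀ P.ξ) y u) =
      P.h ((extChartAt 𝓘(ℝ, E) x₀).symm y) (chartSymmDeriv x₀ y u) := by
  have : CompleteSpace E := FiniteDimensional.complete ℝ E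
  have hinv := isInvertible_chartSymmDeriv hy
  have hx := PartialEquiv.map_target _ hy
  have hX := mdifferentiableAt_constField u hx
  have hξ : MDiffAt (T% P.ξ) ((extChartAt 𝓘(ℝ, E) x₀).symm y) :=
    (P.contMDiff_ξ _).mdifferentiableAt (by simp)
  have hφ := (P.isLocalStructure x₀).hasFDerivAt_Φ hy
  have hev : fieldInChart x₀ (fun x ↦ P.φ x (constField x₀ u x)) =ᶠ[nhds y]
      fun z ↦ P.φInChart x₀ z u := by
    filter_upwards [(isOpen_extChartAt_target x₀).mem_nhds hy] with z hz
    rw [P.fieldInChart_φ _ hz, fieldInChart_constField u hz]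
  have h1 := fieldInChart_mlieBracket hy hξ hX
  have h2 := fieldInChart_mlieBracket hy hξ (P.mdiffAt_φ hX)
  rw [lieBracket_eq] at h1 h2
  simp only [(fieldInChart_constField_eventuallyEq u hy).fderiv_eq, fderiv_fun_const,
    Pi.zero_apply, zero_apply, fieldInChart_constField u hy] at h1
  simp only [hev.fderiv_eq, (hφ.clm_apply_const u).fderiv, hev.eq_of_nhds] at h2
  -- By tensoriality h may be evaluated on the field X with constant coordinates u. There [ξ,X]
  -- reads −Dξ(u) and [ξ,φX] reads Dφ(ξ)u − Dξ(φu).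
  have h3 : P.h ((extChartAt 𝓘(ℝ, E) x₀).symm y) (chartSymmDeriv x₀ y u) =
      (1 / 2 : ℝ) • P.lieφ (constField x₀ u) ((extChartAt 𝓘(ℝ, E) x₀).symm y) := by
    rw [← constField_symm hy]
    exact congrArg (fun w ↦ (1 / 2 : ℝ) • w) (TensorialAt.mkHom_apply (P.tensorialAt_lieφ _) hX)
  refine hinv.inverse.injective ?_
  rw [hinv.inverse_apply_self, h3, lieφ, map_smul, map_sub]
  have h4 := P.fieldInChart_φ (mlieBracket 𝓘(ℝ, E) P.ξ (constField x₀ u)) hy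
  rw [fieldInChart] at h2
  rw [fieldInChart, h1] at h4
  rw [h2, h4, halfLie_apply]
  simp

end Paracontact.MetricStructure

/-! ### Transfer of the local results to the manifold -/

namespace Paracontact.MetricStructure

open PseudoRiemannian VectorField

variable {E : Type*} [NormedAddCommGroup E] [NormedSpace ℝ E] [FiniteDimensional ℝ E]
  {M : Type*} [TopologicalSpace M] [ChartedSpace E M] [IsManifold 𝓘(ℝ, E) ∞ M]
  (P : MetricStructure E M) {x₀ x : M} {y : E}

theorem chartDerivAt_h (hx : x ∈ (extChartAt 𝓘(ℝ, E) x₀).source) (v : TangentSpace 𝓘(ℝ, E) x) :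
    chartDerivAt x₀ x (P.h x v) =
      halfLie (P.φInChart x₀) (fieldInChart x₀ P.ξ) (extChartAt 𝓘(ℝ, E) x₀ x)
        (chartDerivAt x₀ x v) := by
  obtain ⟨y, hy, rfl⟩ : ∃ y ∈ (extChartAt 𝓘(ℝ, E) x₀).target,
      (extChartAt 𝓘(ℝ, E) x₀).symm y = x :=
    ⟨_, PartialEquiv.map_source _ hx, PartialEquiv.left_inv _ hx⟩
  obtain ⟨u, rfl⟩ := (isInvertible_chartSymmDeriv hy).surjective v
  rw [PartialEquiv.right_inv _ hy, chartDerivAt_eq_inverse hy, ← P.chartSymmDeriv_halfLie hy,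
    (isInvertible_chartSymmDeriv hy).inverse_apply_self,
    (isInvertible_chartSymmDeriv hy).inverse_apply_self]

theorem fieldInChart_h (Y : Π x : M, TangentSpace 𝓘(ℝ, E) x)
    (hy : y ∈ (extChartAt 𝓘(ℝ, E) x₀).target) :
    fieldInChart x₀ (fun x ↦ P.h x (Y x)) y =
      halfLie (P.φInChart x₀) (fieldInChart x₀ P.ξ) y (fieldInChart x₀ Y y) := by
  refine (isInvertible_chartSymmDeriv hy).injective ?_
  rw [P.chartSymmDeriv_halfLie hy, fieldInChart, fieldInChart,
    (isInvertible_chartSymmDeriv hy).self_apply_inverse,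
    (isInvertible_chartSymmDeriv hy).self_apply_inverse]

omit [FiniteDimensional ℝ E] in
theorem chartDeriv_l (x : M) (v : TangentSpace 𝓘(ℝ, E) x) :
    chartDeriv x (P.l x v) = localCurvature (P.g.inChart x) (extChartAt 𝓘(ℝ, E) x x)
      (chartDeriv x v) (fieldInChart x P.ξ (extChartAt 𝓘(ℝ, E) x x))
      (fieldInChart x P.ξ (extChartAt 𝓘(ℝ, E) x x)) := by
  rw [← chartDerivAt_apply_field (mem_extChartAt_source x)]
  exact P.g.chartDeriv_curvature x v (P.ξ x) (P.ξ x)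

theorem val_φ_left (x : M) (v w : TangentSpace 𝓘(ℝ, E) x) :
    P.g.val x (P.φ x v) w = -P.g.val x v (P.φ x w) := by
  have hx := mem_extChartAt_source (I := 𝓘(ℝ, E)) x
  rw [← P.g.inChart_chartDerivAt hx, ← P.g.inChart_chartDerivAt hx, P.chartDerivAt_φ hx,
    P.chartDerivAt_φ hx, (P.isLocalStructure x).G_Φ_left (mem_extChartAt_target x)]

theorem ricci_φ_left {x : M}
    (hS : ∀ v, P.g.ricciOperator x (P.φ x v) = P.φ x (P.g.ricciOperator x v))
    (v w : TangentSpace 𝓘(ℝ, E) x) :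
    P.g.ricci x (P.φ x v) w = -P.g.ricci x v (P.φ x w) := by
  rw [← P.g.val_ricciOperator, hS, P.val_φ_left, P.g.val_ricciOperator]

theorem l_φ (hdim : Module.finrank ℝ E = 3) {x : M}
    (hS : ∀ v, P.g.ricciOperator x (P.φ x v) = P.φ x (P.g.ricciOperator x v))
    (v : TangentSpace 𝓘(ℝ, E) x) : P.l x (P.φ x v) = P.φ x (P.l x v) := by
  have hx := mem_extChartAt_source (I := 𝓘(ℝ, E)) x
  refine (Metric.isInvertible_chartDeriv x).injective ?_
  rw [P.chartDeriv_l, Metric.chartDeriv_eq, P.chartDerivAt_φ hx, P.chartDerivAt_φ hx,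
    ← Metric.chartDeriv_eq, P.chartDeriv_l]
  refine (P.isLocalStructure x).localCurvature_Φ_Ξ_Ξ (mem_extChartAt_target x) hdim
    (fun a b ↦ ?_) _
  obtain ⟨v, rfl⟩ := (Metric.isInvertible_chartDeriv x).surjective a
  obtain ⟨w, rfl⟩ := (Metric.isInvertible_chartDeriv x).surjective b
  have h := P.ricci_φ_left hS v w
  rw [P.g.ricci_eq, P.g.ricci_eq, Metric.chartDeriv_eq, P.chartDerivAt_φ hx,
    P.chartDerivAt_φ hx] at h
  exact h

theorem covDerivAlong_halfLie_inChart {x : M}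
    (hl : ∀ v : TangentSpace 𝓘(ℝ, E) x, P.l x (P.φ x v) = P.φ x (P.l x v)) :
    covDerivAlong (P.g.inChart x) (fieldInChart x P.ξ)
      (halfLie (P.φInChart x) (fieldInChart x P.ξ)) (extChartAt 𝓘(ℝ, E) x x) = 0 := by
  have hx := mem_extChartAt_source (I := 𝓘(ℝ, E)) x
  refine (P.isLocalStructure x).covDerivAlong_halfLie_eq_zero (mem_extChartAt_target x)
    fun a ↦ ?_
  obtain ⟨v, rfl⟩ := (Metric.isInvertible_chartDeriv x).surjective a
  have h := congrArg (chartDeriv x) (hl v)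
  rwa [P.chartDeriv_l, Metric.chartDeriv_eq, P.chartDerivAt_φ hx, P.chartDerivAt_φ hx,
    ← Metric.chartDeriv_eq, P.chartDeriv_l] at h

theorem l_eq {x : M} (hl : ∀ v : TangentSpace 𝓘(ℝ, E) x, P.l x (P.φ x v) = P.φ x (P.l x v))
    (v : TangentSpace 𝓘(ℝ, E) x) : P.l x v = P.h x (P.h x v) - P.φ x (P.φ x v) := by
  have hx := mem_extChartAt_source (I := 𝓘(ℝ, E)) x
  refine (Metric.isInvertible_chartDeriv x).injective ?_
  rw [P.chartDeriv_l, (P.isLocalStructure x).localCurvature_Ξ_Ξ (mem_extChartAt_target x),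
    P.covDerivAlong_halfLie_inChart hl, map_sub, Metric.chartDeriv_eq, P.chartDerivAt_φ hx,
    P.chartDerivAt_φ hx, P.chartDerivAt_h hx, P.chartDerivAt_h hx, zero_apply, map_zero, sub_zero]

/-- By the Leibniz rule the derivatives of Y cancel, so the expression depends only on Y at x and
equals the local ∇_ξh. -/
theorem covDerivEnd_h {x : M}
    (hl : ∀ v : TangentSpace 𝓘(ℝ, E) x, P.l x (P.φ x v) = P.φ x (P.l x v))
    {Y : Π x : M, TangentSpace 𝓘(ℝ, E) x} (hY : MDiffAt (T% Y) x) :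
    P.g.covDerivEnd (fun y ↦ P.h y) P.ξ Y x = 0 := by
  have : CompleteSpace E := FiniteDimensional.complete ℝ E
  have hx := mem_extChartAt_source (I := 𝓘(ℝ, E)) x
  have hy := mem_extChartAt_target (I := 𝓘(ℝ, E)) x
  have hL := P.isLocalStructure x
  have hev : fieldInChart x (fun z ↦ P.h z (Y z)) =ᶠ[nhds (extChartAt 𝓘(ℝ, E) x x)]
      fun z ↦ halfLie (P.φInChart x) (fieldInChart x P.ξ) z (fieldInChart x Y z) :=
    Filter.eventuallyEq_of_mem ((isOpen_extChartAt_target x).mem_nhds hy)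
      fun _ hz ↦ P.fieldInChart_h Y hz
  have hd := (hL.hasFDerivAt_halfLie hy).clm_apply (differentiableAt_fieldInChart x hY).hasFDerivAt
  have hK := DFunLike.congr_fun (P.covDerivAlong_halfLie_inChart hl)
    (fieldInChart x Y (extChartAt 𝓘(ℝ, E) x x))
  rw [covDerivAlong_apply, zero_apply] at hK
  refine (Metric.isInvertible_chartDeriv x).injective ?_
  rw [Metric.covDerivEnd, map_sub, map_zero, P.g.chartDeriv_leviCivita, Metric.chartDeriv_eq,
    P.chartDerivAt_h hx, P.chartDerivAt_h hx, ← Metric.chartDeriv_eq, P.g.chartDeriv_leviCivita,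
    Metric.chartDeriv_eq, chartDerivAt_apply_field hx, chartDerivAt_apply_field hx, hev.fderiv_eq,
    hd.fderiv]
  simp only [map_add, add_apply, ContinuousLinearMap.comp_apply, ContinuousLinearMap.flip_apply]
  linear_combination (norm := module) hK

theorem mdifferentiableAt_traceL_and_mvfderiv_eq_zero (hl : ∀ x, ∀ v : TangentSpace 𝓘(ℝ, E) x,
    P.l x (P.φ x v) = P.φ x (P.l x v)) (x : M) :
    MDifferentiableAt 𝓘(ℝ, E) 𝓘(ℝ, ℝ) P.traceL x ∧
      mvfderiv 𝓘(ℝ, E) P.traceL x (P.ξ x) = 0 := by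
  have hx := mem_extChartAt_source (I := 𝓘(ℝ, E)) x
  obtain ⟨L, hL, hLξ⟩ := (P.isLocalStructure x).exists_hasFDerivAt_trace_sub
    (mem_extChartAt_target x) (P.covDerivAlong_halfLie_inChart (hl x))
  -- Each value of l uses a different chart, so l is first replaced by h² − φ² at every nearby
  -- point; that expression is then read in the single chart at x.
  have hev : P.traceL =ᶠ[nhds x] (fun z ↦ LinearMap.trace ℝ E
      ((halfLie (P.φInChart x) (fieldInChart x P.ξ) z ∘L
        halfLie (P.φInChart x) (fieldInChart x P.ξ) z -
        P.φInChart x z ∘L P.φInChart x z : E →L[ℝ] E) : E →ₗ[ℝ] E)) ∘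
      extChartAt 𝓘(ℝ, E) x := by
    filter_upwards [extChartAt_source_mem_nhds (I := 𝓘(ℝ, E)) x] with z hz
    refine trace_eq_of_chartDerivAt hz _ _ fun v ↦ ?_
    rw [P.l_eq (hl z), map_sub, P.chartDerivAt_φ hz, P.chartDerivAt_φ hz, P.chartDerivAt_h hz,
      P.chartDerivAt_h hz]
    rfl
  have hd : HasMFDerivAt 𝓘(ℝ, E) 𝓘(ℝ, ℝ) P.traceL x (L ∘L chartDerivAt x x) :=
    (hL.hasMFDerivAt.comp x ((contMDiffAt_extChartAt_of_mem hx).mdifferentiableAt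
      (by simp)).hasMFDerivAt).congr_of_eventuallyEq hev
  refine ⟨hd.mdifferentiableAt, ?_⟩
  rw [← chartDerivAt_apply_field hx] at hLξ
  rw [mvfderiv, hd.mfderiv]
  exact hLξ

end Paracontact.MetricStructure

end

theorem mainTheorem2 (M : Type*) [TopologicalSpace M] [ChartedSpace (EuclideanSpace ℝ (Fin 3)) M]
    [IsManifold 𝓘(ℝ, EuclideanSpace ℝ (Fin 3)) ∞ M]
    (P : Paracontact.MetricStructure (EuclideanSpace ℝ (Fin 3)) M)
    (hS : ∀ (x : M) (v : TangentSpace 𝓘(ℝ, EuclideanSpace ℝ (Fin 3)) x),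
      P.g.ricciOperator x (P.φ x v) = P.φ x (P.g.ricciOperator x v)) :
    (∀ (x : M) (v : TangentSpace 𝓘(ℝ, EuclideanSpace ℝ (Fin 3)) x),
      P.l x (P.φ x v) = P.φ x (P.l x v)) ∧
    (∀ (x : M) (v : TangentSpace 𝓘(ℝ, EuclideanSpace ℝ (Fin 3)) x),
      P.l x v = P.h x (P.h x v) - P.φ x (P.φ x v)) ∧
    (∀ (x : M) (Y : Π x : M, TangentSpace 𝓘(ℝ, EuclideanSpace ℝ (Fin 3)) x),
      MDifferentiableAt 𝓘(ℝ, EuclideanSpace ℝ (Fin 3)) 𝓘(ℝ, EuclideanSpace ℝ (Fin 3)).tangent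
        (fun y ↦ (⟨y, Y y⟩ : TangentBundle 𝓘(ℝ, EuclideanSpace ℝ (Fin 3)) M)) x →
      P.g.covDerivEnd (fun y ↦ P.h y) P.ξ Y x = 0) ∧
    (MDifferentiable 𝓘(ℝ, EuclideanSpace ℝ (Fin 3)) 𝓘(ℝ, ℝ) P.traceL ∧
      ∀ x : M, mvfderiv 𝓘(ℝ, EuclideanSpace ℝ (Fin 3)) P.traceL x (P.ξ x) = 0) := by
  have hl : ∀ (x : M) (v : TangentSpace 𝓘(ℝ, EuclideanSpace ℝ (Fin 3)) x),
      P.l x (P.φ x v) = P.φ x (P.l x v) := fun x v ↦ P.l_φ (by simp) (hS x) v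
  exact ⟨hl, fun x v ↦ P.l_eq (hl x) v, fun x Y hY ↦ P.covDerivEnd_h (hl x) hY,
    fun x ↦ (P.mdifferentiableAt_traceL_and_mvfderiv_eq_zero hl x).1,
    fun x ↦ (P.mdifferentiableAt_traceL_and_mvfderiv_eq_zero hl x).2⟩
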